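/- Let $N\ge 1$, let $\mathcal R\subset\mathbb R^N$ be a root system (a finite set of nonzero vectors with $\mathcal R\cap\mathbb R\alpha=\{\pm\alpha\}$ and $s_\alpha\mathcal R=\mathcal R$ for all $\alpha\in\mathcal R$, where $s_\alpha$ is the orthogonal reflection in $\alpha^\perp$), and let $\mu:\mathcal R\to[0,\infty)$ be invariant under the Coxeter group generated by the $s_\alpha$. Write $z\cdot w=\sum_i z_iw_i$ and $z^2=z\cdot z$ on $\mathbb C^N$. Let $E_\mu:\mathbb C^N\times\mathbb C^N\to\mathbb C$ be the Dunkl kernel: for each $w\in\mathbb C^N$, $E_\mu(\cdot,w)$ is the unique entire function $f$ on $\mathbb C^N$ with $f(0)=1$ and $T_\xi f=(\xi\cdot w)f$ for all $\xi\in\mathbb C^N$, where $$T_\xi f(z)=\partial_\xi f(z)+\frac12\sum_{\alpha\in\mathcal R}\mu(\alpha)\,(\alpha\cdot\xi)\,\frac{f(z)-f(s_\alpha z)}{\alpha\cdot z}$$ is the Dunkl operator. For $t>0$, $z,w\in\mathbb C^N$ and $q\in\mathbb R^N$ put $$\rho_{\mu,t}(z,w)=e^{-(z^2+w^2)/2t}\,E_\mu\!\left(\tfrac{z}{t^{1/2}},\tfrac{w}{t^{1/2}}\right),\qquad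 \sigma_{\mu,t}(q)=\rho_{\mu,t}(0,q),$$ $$A_{\mu,t}(z,q)=e^{-z^2/2t-q^2/4t}\,E_\mu\!\left(\tfrac{z}{t^{1/2}},\tfrac{q}{t^{1/2}}\right),\qquad B_{\mu,t}(z,q)=\frac{\rho_{\mu,t}(z,q)}{\rho_{\mu,t}(0,q)},\qquad C_{\mu,t}(z,q)=\rho_{\mu,t}(z,q).$$ Then for every $t>0$, $z\in\mathbb C^N$ and $q\in\mathbb R^N$ one has $\sigma_{\mu,t}(q)=e^{-q^2/2t}>0$ (so that the quotients and the positive square root below make sense) and \begin{align*} B_{\mu,t}(z,q)&=A_{\mu,t}(z,q)/A_{\mu,t}(0,q),\\ \rho_{\mu,t}(z,q)=C_{\mu,t}(z,q)&=A_{\mu,t}(0,q)\,A_{\mu,t}(z,q),\\ \sigma_{\mu,t}(q)=\rho_{\mu,t}(0,q)&=\left(A_{\mu,t}(0,q)\right)^2,\\ C_{\mu,t}(2z,q)&=A_{\mu,2t}(2z,0)\,A_{\mu,t/2}(z,q), \end{align*} and also \begin{align*} A_{\mu,t}(z,q)&=C_{\mu,t}(z,q)/\left(C_{\mu,t}(0,q)\right)^{1/2},\\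 B_{\mu,t}(z,q)&=C_{\mu,t}(z,q)/C_{\mu,t}(0,q),\\ \sigma_{\mu,t}(q)=\rho_{\mu,t}(0,q)&=C_{\mu,t}(0,q). \end{align*} Consequently Version $A$ determines Versions $B$, $C$ and the heat kernel, and Version $C$ determines Versions $A$, $B$ and the heat kernel: if $(\mathcal R,\mu,t)$ and $(\mathcal R',\mu',t')$ are two sets of data as above in $\mathbb R^N$, then equality of the two kernels $A$ as functions of $(z,q)$ implies equality of the two kernels $B$, of the two kernels $C$ and of the two functions $\sigma$; and equality of the two kernels $C$ implies equality of the two kernels $A$, of the two kernels $B$ and of the two functions $\sigma$. -/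

import Mathlib

open Matrix

noncomputable section

/-- A (reduced, not necessarily crystallographic or spanning) root system in `ℝ^N`: a finite set of
nonzero vectors with `R ∩ ℝα = {α, -α}` and `s_α R ⊆ R` for every `α ∈ R`, where `s_α` is the
orthogonal reflection in the hyperplane perpendicular to `α`. -/
structure IsRootSystem {N : ℕ} (R : Finset (EuclideanSpace ℝ (Fin N))) : Prop where
  zero_notMem : (0 : EuclideanSpace ℝ (Fin N)) ∉ R
  smul_mem_iff : ∀ α ∈ R, ∀ c : ℝ, c • α ∈ R ↔ c = 1 ∨ c = -1
  reflection_mem : ∀ α ∈ R, ∀ β ∈ R, (Submodule.span ℝ {α})ᗮ.reflection β ∈ R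

/-- The Coxeter group of `R`: the subgroup of the orthogonal group of `ℝ^N` generated by the
reflections in the hyperplanes perpendicular to the elements of `R`. -/
def coxeterGroup {N : ℕ} (R : Finset (EuclideanSpace ℝ (Fin N))) :
    Subgroup (EuclideanSpace ℝ (Fin N) ≃ₗᵢ[ℝ] EuclideanSpace ℝ (Fin N)) :=
  Subgroup.closure ((fun α => (Submodule.span ℝ {α})ᗮ.reflection) '' (R : Set _))

/-- Nonnegative multiplicity functions on `R`, i.e. nonnegative functions on `R` invariant under
the Coxeter group. Only the values of `μ` on `R` matter. -/
structure IsMultiplicityFunction {N : ℕ} (R : Finset (EuclideanSpace ℝ (Fin N)))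
    (μ : EuclideanSpace ℝ (Fin N) → ℝ) : Prop where
  nonneg : ∀ α ∈ R, 0 ≤ μ α
  invariant : ∀ g ∈ coxeterGroup R, ∀ α ∈ R, μ (g α) = μ α

/-- The inclusion `ℝ^N ⊆ ℂ^N`. -/
def toComplexVec {N : ℕ} (x : EuclideanSpace ℝ (Fin N)) : Fin N → ℂ :=
  fun i => (x i : ℂ)

/-- The complex-linear extension to `ℂ^N` of the reflection `s_α`. Here `⬝ᵥ` is the bilinear
product `z · w = ∑ i, z i * w i`. -/
def complexReflection {N : ℕ} (α : EuclideanSpace ℝ (Fin N)) (z : Fin N → ℂ) : Fin N → ℂ :=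
  z - (2 * (toComplexVec α ⬝ᵥ z) / (toComplexVec α ⬝ᵥ toComplexVec α)) • toComplexVec α

/-- The points of `ℂ^N` that lie off all the (complexified) reflection hyperplanes. -/
def IsRegularPoint {N : ℕ} (R : Finset (EuclideanSpace ℝ (Fin N))) (z : Fin N → ℂ) : Prop :=
  ∀ α ∈ R, toComplexVec α ⬝ᵥ z ≠ 0

/-- The Dunkl operator
`T_ξ f (z) = ∂_ξ f (z) + ½ ∑_{α ∈ R} μ(α) (α·ξ) (f(z) - f(s_α z)) / (α·z)`
for holomorphic `f`, at regular points `z`. As the summand is unchanged under `α ↦ -α`, half the sum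
over `R` is the sum over a positive subsystem. -/
def dunklOperator {N : ℕ} (R : Finset (EuclideanSpace ℝ (Fin N)))
    (μ : EuclideanSpace ℝ (Fin N) → ℝ) (ξ : Fin N → ℂ) (f : (Fin N → ℂ) → ℂ)
    (z : Fin N → ℂ) : ℂ :=
  fderiv ℂ f z ξ + (1 / 2) * ∑ α ∈ R, (μ α : ℂ) * (toComplexVec α ⬝ᵥ ξ) *
    ((f z - f (complexReflection α z)) / (toComplexVec α ⬝ᵥ z))

/-- `f` is a normalized joint eigenfunction of the Dunkl operators with spectral parameter `w`:
an entire function on `ℂ^N` with `T_ξ f = (ξ·w) f` for all `ξ`, and `f 0 = 1`. The equation is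
imposed at regular points, which are dense; for holomorphic `f` this is the equation everywhere,
the difference quotients being extended across the hyperplanes by continuity. -/
structure IsDunklEigenfunction {N : ℕ} (R : Finset (EuclideanSpace ℝ (Fin N)))
    (μ : EuclideanSpace ℝ (Fin N) → ℝ) (w : Fin N → ℂ) (f : (Fin N → ℂ) → ℂ) : Prop where
  differentiable : Differentiable ℂ f
  eigen : ∀ ξ z : Fin N → ℂ, IsRegularPoint R z → dunklOperator R μ ξ f z = (ξ ⬝ᵥ w) * f z
  map_zero : f 0 = 1

open Classical in
/-- The holomorphic Dunkl kernel `E_μ(z, w)`: as a function of `z` it is the (unique, for `μ ≥ 0`)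
normalized joint eigenfunction of the Dunkl operators with spectral parameter `w`. -/
def dunklKernel {N : ℕ} (R : Finset (EuclideanSpace ℝ (Fin N)))
    (μ : EuclideanSpace ℝ (Fin N) → ℝ) (z w : Fin N → ℂ) : ℂ :=
  if h : ∃ f, IsDunklEigenfunction R μ w f then Classical.choose h z else 0

/-- `ρ_{μ,t}(z,w) = e^{-(z² + w²)/2t} E_μ(z/t^{1/2}, w/t^{1/2})`, for `z, w ∈ ℂ^N`. -/
def dunklRho {N : ℕ} (R : Finset (EuclideanSpace ℝ (Fin N)))
    (μ : EuclideanSpace ℝ (Fin N) → ℝ) (t : ℝ) (z w : Fin N → ℂ) : ℂ :=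
  Complex.exp (-(z ⬝ᵥ z + w ⬝ᵥ w) / (2 * t)) *
    dunklKernel R μ ((Real.sqrt t : ℂ)⁻¹ • z) ((Real.sqrt t : ℂ)⁻¹ • w)

/-- The one-variable Dunkl heat kernel `σ_{μ,t}(q) = ρ_{μ,t}(0,q)`, for `q ∈ ℝ^N`. -/
def dunklSigma {N : ℕ} (R : Finset (EuclideanSpace ℝ (Fin N)))
    (μ : EuclideanSpace ℝ (Fin N) → ℝ) (t : ℝ) (q : EuclideanSpace ℝ (Fin N)) : ℂ :=
  dunklRho R μ t 0 (toComplexVec q)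

/-- The Version A kernel `A_{μ,t}(z,q) = e^{-z²/2t - q²/4t} E_μ(z/t^{1/2}, q/t^{1/2})`. -/
def kernelA {N : ℕ} (R : Finset (EuclideanSpace ℝ (Fin N)))
    (μ : EuclideanSpace ℝ (Fin N) → ℝ) (t : ℝ) (z : Fin N → ℂ)
    (q : EuclideanSpace ℝ (Fin N)) : ℂ :=
  Complex.exp (-(z ⬝ᵥ z) / (2 * t) - (toComplexVec q ⬝ᵥ toComplexVec q) / (4 * t)) *
    dunklKernel R μ ((Real.sqrt t : ℂ)⁻¹ • z) ((Real.sqrt t : ℂ)⁻¹ • toComplexVec q)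

/-- The Version B kernel `B_{μ,t}(z,q) = ρ_{μ,t}(z,q) / ρ_{μ,t}(0,q)`. -/
def kernelB {N : ℕ} (R : Finset (EuclideanSpace ℝ (Fin N)))
    (μ : EuclideanSpace ℝ (Fin N) → ℝ) (t : ℝ) (z : Fin N → ℂ)
    (q : EuclideanSpace ℝ (Fin N)) : ℂ :=
  dunklRho R μ t z (toComplexVec q) / dunklRho R μ t 0 (toComplexVec q)

/-- The Version C kernel `C_{μ,t}(z,q) = ρ_{μ,t}(z,q)`. -/
def kernelC {N : ℕ} (R : Finset (EuclideanSpace ℝ (Fin N)))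
    (μ : EuclideanSpace ℝ (Fin N) → ℝ) (t : ℝ) (z : Fin N → ℂ)
    (q : EuclideanSpace ℝ (Fin N)) : ℂ :=
  dunklRho R μ t z (toComplexVec q)

end

/-!
The relations between the kernels reduce to four properties of the Dunkl kernel `E(z, w)`: it
exists, `E(0, w) = 1`, `E(z, 0) = 1`, and `E(c z, w) = E(z, c w)`. The last two follow from
uniqueness, as `1` and `z ↦ E(c z, w)` are normalized joint eigenfunctions for the spectral
parameters `0` and `c w`. So everything rests on existence and uniqueness of the normalized joint
eigenfunction of the Dunkl operators, which are proved together from the radial equation.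

Since `∑ z_i T_i = ∑ z_i ∂_i + ½ ∑ μ(α) (1 - s_α)` (`sum_X_mul_dunklPoly`), the homogeneous
components `f_n` of an eigenfunction satisfy
`(n + 1) f_{n+1} + ½ ∑ μ(α) (f_{n+1} - f_{n+1} ∘ s_α) = (w·z) f_n`.
As `μ ≥ 0`, looking at a maximum point of `|f_{n+1}|` on a Hermitian ball, which is invariant under
the reflections, gives `(n + 1) max |f_{n+1}| ≤ max |w·z| max |f_n|`
(`norm_le_div_of_norm_averaging_le`). This estimate has four uses.

* On homogeneous polynomials of degree `n + 1` the operator on the left-hand side is injective, hence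
  bijective, so that the components can be computed recursively (`exists_isRadialSequence`).
* The polynomials so obtained satisfy the full equation `T_ξ f_{n+1} = (ξ·w) f_n`: the defect, as a
  function of the pair `(ξ, z)`, solves a homogeneous equation of the same type
  (`dunklPoly_eq_of_radial`). This is the only place where the commutativity of the Dunkl operators
  (`dunklPoly_comm`) is needed.
* `|f_n| ≤ Bⁿ / n!` on every ball, so that `∑ f_n` is entire and can be differentiated termwise
  (`exists_isDunklEigenfunction`).
* An entire eigenfunction vanishing at `0` vanishes identically, because its homogeneous components,
  written as Cauchy integrals along complex lines, vanish one after the other (`eq_zero_of_eigen`).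
-/

section DunklKernel

variable {N : ℕ}

/-! ### Reflections of `ℂ^N` -/

theorem dotProduct_toComplexVec_ofReal (x y : EuclideanSpace ℝ (Fin N)) :
    toComplexVec x ⬝ᵥ toComplexVec y = ((inner ℝ x y : ℝ) : ℂ) := by
  simp [dotProduct, toComplexVec, PiLp.inner_apply, mul_comm]

theorem dotProduct_toComplexVec_self (x : EuclideanSpace ℝ (Fin N)) :
    toComplexVec x ⬝ᵥ toComplexVec x = ((‖x‖ ^ 2 : ℝ) : ℂ) := by
  rw [dotProduct_toComplexVec_ofReal, real_inner_self_eq_norm_sq]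

theorem dotProduct_toComplexVec_self_ne_zero {α : EuclideanSpace ℝ (Fin N)} (hα : α ≠ 0) :
    toComplexVec α ⬝ᵥ toComplexVec α ≠ 0 := by
  rw [dotProduct_toComplexVec_self]
  exact_mod_cast pow_ne_zero 2 (norm_ne_zero_iff.2 hα)

theorem complexReflection_apply (α : EuclideanSpace ℝ (Fin N)) (z : Fin N → ℂ) (i : Fin N) :
    complexReflection α z i = z i - 2 * toComplexVec α i /
      (toComplexVec α ⬝ᵥ toComplexVec α) * (toComplexVec α ⬝ᵥ z) := by
  simp only [complexReflection, Pi.sub_apply, Pi.smul_apply, smul_eq_mul]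
  ring

theorem dotProduct_complexReflection_left (α : EuclideanSpace ℝ (Fin N)) (w z : Fin N → ℂ) :
    complexReflection α w ⬝ᵥ z = w ⬝ᵥ z - 2 * (toComplexVec α ⬝ᵥ w) /
      (toComplexVec α ⬝ᵥ toComplexVec α) * (toComplexVec α ⬝ᵥ z) := by
  simp only [complexReflection, sub_dotProduct, smul_dotProduct, smul_eq_mul]

theorem dotProduct_complexReflection_right (α : EuclideanSpace ℝ (Fin N)) (w z : Fin N → ℂ) :
    w ⬝ᵥ complexReflection α z = w ⬝ᵥ z - 2 * (toComplexVec α ⬝ᵥ w) /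
      (toComplexVec α ⬝ᵥ toComplexVec α) * (toComplexVec α ⬝ᵥ z) := by
  rw [dotProduct_comm, dotProduct_complexReflection_left, dotProduct_comm z w]
  ring

theorem complexReflection_dotProduct_comm (α : EuclideanSpace ℝ (Fin N)) (w z : Fin N → ℂ) :
    complexReflection α w ⬝ᵥ z = w ⬝ᵥ complexReflection α z := by
  rw [dotProduct_complexReflection_left, dotProduct_complexReflection_right]

theorem complexReflection_smul (α : EuclideanSpace ℝ (Fin N)) (c : ℂ) (z : Fin N → ℂ) :
    complexReflection α (c • z) = c • complexReflection α z := by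
  ext i
  simp only [complexReflection_apply, Pi.smul_apply, smul_eq_mul, dotProduct_smul]
  ring

theorem complexReflection_complexReflection {α : EuclideanSpace ℝ (Fin N)} (hα : α ≠ 0)
    (z : Fin N → ℂ) : complexReflection α (complexReflection α z) = z := by
  have h := dotProduct_toComplexVec_self_ne_zero hα
  ext i
  rw [complexReflection_apply, dotProduct_complexReflection_right, complexReflection_apply]
  field_simp
  ring

theorem continuous_complexReflection (α : EuclideanSpace ℝ (Fin N)) :
    Continuous (complexReflection α) := by
  refine continuous_pi fun i => ?_
  simp only [complexReflection_apply, dotProduct]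
  fun_prop

theorem star_toComplexVec (α : EuclideanSpace ℝ (Fin N)) :
    star (toComplexVec α) = toComplexVec α := by
  ext i
  simp [toComplexVec]

theorem star_complexReflection (α : EuclideanSpace ℝ (Fin N)) (z : Fin N → ℂ) :
    star (complexReflection α z) = complexReflection α (star z) := by
  have h1 : ∀ u v : Fin N → ℂ, star (u ⬝ᵥ v) = star u ⬝ᵥ star v := fun u v => by
    rw [← star_dotProduct_star, dotProduct_comm]
  ext i
  have h2 : star (toComplexVec α i) = toComplexVec α i := by simp [toComplexVec]
  rw [Pi.star_apply, complexReflection_apply, complexReflection_apply, star_sub, star_mul',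
    h1, star_div₀, star_mul', h1, star_toComplexVec, h2]
  simp

theorem toComplexVec_reflection (α β : EuclideanSpace ℝ (Fin N)) :
    toComplexVec ((Submodule.span ℝ {α})ᗮ.reflection β) =
      complexReflection α (toComplexVec β) := by
  ext i
  rw [complexReflection_apply, dotProduct_toComplexVec_self, dotProduct_toComplexVec_ofReal,
    Submodule.reflection_orthogonal_apply, Submodule.reflection_singleton_apply]
  simp only [toComplexVec, PiLp.neg_apply, PiLp.sub_apply, PiLp.smul_apply, smul_eq_mul,
    nsmul_eq_mul]
  push_cast
  simp
  ring

/-- Conjugation of a reflection by a reflection, in the form `s_{s_α β} s_α = s_α s_β`. -/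
theorem complexReflection_reflection {α : EuclideanSpace ℝ (Fin N)} (hα : α ≠ 0)
    (β : EuclideanSpace ℝ (Fin N)) (z : Fin N → ℂ) :
    complexReflection ((Submodule.span ℝ {α})ᗮ.reflection β) (complexReflection α z) =
      complexReflection α (complexReflection β z) := by
  have h := dotProduct_toComplexVec_self_ne_zero hα
  have h1 : ∀ w, complexReflection α (toComplexVec β) ⬝ᵥ complexReflection α w =
      toComplexVec β ⬝ᵥ w := fun w => by
    rw [complexReflection_dotProduct_comm, complexReflection_complexReflection hα]
  ext i
  rw [complexReflection_apply _ (complexReflection α z), toComplexVec_reflection, h1, h1]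
  simp only [complexReflection_apply, dotProduct_complexReflection_right,
    dotProduct_comm (toComplexVec β) (toComplexVec α)]
  ring

/-- The closed Hermitian ball of squared radius `r` in `ℂ^N`. Unlike the balls of the sup norm
carried by `Fin N → ℂ`, it is invariant under the reflections. -/
def hermitianBall (N : ℕ) (r : ℝ) : Set (Fin N → ℂ) := {z | (z ⬝ᵥ star z).re ≤ r}

theorem mem_hermitianBall {r : ℝ} {z : Fin N → ℂ} :
    z ∈ hermitianBall N r ↔ (z ⬝ᵥ star z).re ≤ r := Iff.rfl

theorem re_dotProduct_star (z : Fin N → ℂ) : (z ⬝ᵥ star z).re = ∑ i, ‖z i‖ ^ 2 := by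
  simp only [dotProduct, Complex.re_sum, Pi.star_apply]
  refine Finset.sum_congr rfl fun i _ => ?_
  rw [Complex.star_def, Complex.mul_conj, Complex.normSq_eq_norm_sq, Complex.ofReal_re]

theorem mapsTo_complexReflection_hermitianBall {α : EuclideanSpace ℝ (Fin N)} (hα : α ≠ 0)
    (r : ℝ) : Set.MapsTo (complexReflection α) (hermitianBall N r) (hermitianBall N r) := by
  intro z hz
  rw [mem_hermitianBall, star_complexReflection, complexReflection_dotProduct_comm,
    complexReflection_complexReflection hα]
  exact hz

theorem isCompact_hermitianBall (r : ℝ) : IsCompact (hermitianBall N r) := by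
  refine (isCompact_closedBall (0 : Fin N → ℂ) (Real.sqrt r)).of_isClosed_subset ?_ ?_
  · exact isClosed_le (by simp only [re_dotProduct_star]; fun_prop) continuous_const
  · intro z hz
    rw [mem_hermitianBall, re_dotProduct_star] at hz
    rw [mem_closedBall_zero_iff, pi_norm_le_iff_of_nonneg (Real.sqrt_nonneg _)]
    intro i
    refine Real.le_sqrt_of_sq_le (le_trans ?_ hz)
    exact Finset.single_le_sum (f := fun i => ‖z i‖ ^ 2) (fun _ _ => by positivity)
      (Finset.mem_univ i)

theorem closedBall_subset_hermitianBall (r : ℝ) :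
    Metric.closedBall (0 : Fin N → ℂ) r ⊆ hermitianBall N (N * r ^ 2) := by
  intro z hz
  rw [mem_closedBall_zero_iff] at hz
  rw [mem_hermitianBall, re_dotProduct_star]
  calc ∑ i, ‖z i‖ ^ 2 ≤ ∑ _i : Fin N, r ^ 2 :=
        Finset.sum_le_sum fun i _ => pow_le_pow_left₀ (norm_nonneg _)
          ((norm_le_pi_norm z i).trans hz) 2
    _ = N * r ^ 2 := by simp

theorem exists_mem_hermitianBall (z w : Fin N → ℂ) :
    ∃ r, z ∈ hermitianBall N r ∧ w ∈ hermitianBall N r :=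
  ⟨max (z ⬝ᵥ star z).re (w ⬝ᵥ star w).re, mem_hermitianBall.2 (le_max_left _ _),
    mem_hermitianBall.2 (le_max_right _ _)⟩

/-! ### The maximum principle -/

/-- A maximum principle: at a point where `‖H‖` is maximal on `K`, the averaging terms
`H x - H (σ i x)` with nonnegative weights cannot cancel `c * H x`. This is where the
nonnegativity of the multiplicity function enters. -/
theorem norm_le_div_of_norm_averaging_le {X ι : Type*} [TopologicalSpace X] {K : Set X}
    (hK : IsCompact K) (S : Finset ι) (m : ι → ℝ) (hm : ∀ i ∈ S, 0 ≤ m i) (σ : ι → X → X)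
    (hσ : ∀ i ∈ S, Set.MapsTo (σ i) K K) {H : X → ℂ} (hH : ContinuousOn H K) {c : ℝ}
    (hc : 0 < c) {M : ℝ}
    (hM : ∀ x ∈ K, ‖c * H x + 1 / 2 * ∑ i ∈ S, (m i : ℂ) * (H x - H (σ i x))‖ ≤ M) :
    ∀ x ∈ K, ‖H x‖ ≤ M / c := by
  intro x hx
  obtain ⟨y, hy, hmax⟩ := hK.exists_isMaxOn ⟨x, hx⟩ hH.norm
  have hmax' : ∀ u ∈ K, ‖H u‖ ≤ ‖H y‖ := fun u hu => hmax hu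
  refine (hmax' x hx).trans ?_
  rw [le_div_iff₀ hc]
  have h1 : ‖∑ i ∈ S, (m i : ℂ) * H (σ i y)‖ ≤ (∑ i ∈ S, m i) * ‖H y‖ := by
    rw [Finset.sum_mul]
    refine norm_sum_le_of_le _ fun i hi => ?_
    rw [norm_mul, Complex.norm_real, Real.norm_of_nonneg (hm i hi)]
    exact mul_le_mul_of_nonneg_left (hmax' _ (hσ i hi hy)) (hm i hi)
  have h2 : ((c + 1 / 2 * ∑ i ∈ S, m i : ℝ) : ℂ) * H y =
      (c * H y + 1 / 2 * ∑ i ∈ S, (m i : ℂ) * (H y - H (σ i y))) +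
        1 / 2 * ∑ i ∈ S, (m i : ℂ) * H (σ i y) := by
    simp only [mul_sub, Finset.sum_sub_distrib, ← Finset.sum_mul]
    push_cast
    ring
  have h3 := norm_add_le (c * H y + 1 / 2 * ∑ i ∈ S, (m i : ℂ) * (H y - H (σ i y)))
    (1 / 2 * ∑ i ∈ S, (m i : ℂ) * H (σ i y))
  have h4 : 0 ≤ ∑ i ∈ S, m i := Finset.sum_nonneg hm
  rw [← h2, norm_mul, norm_mul, Complex.norm_real, Real.norm_of_nonneg (by positivity)] at h3
  have h5 := hM y hy
  norm_num at h3
  nlinarith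

/-! ### Dunkl operators on polynomials -/

section Polynomials

open MvPolynomial

/-- The linear form `z ↦ a · z` as a polynomial. -/
noncomputable def linearForm (a : Fin N → ℂ) : MvPolynomial (Fin N) ℂ := ∑ i, C (a i) * X i

theorem eval_linearForm (a z : Fin N → ℂ) : eval z (linearForm a) = a ⬝ᵥ z := by
  simp [linearForm, dotProduct]

theorem linearForm_ne_zero {α : EuclideanSpace ℝ (Fin N)} (hα : α ≠ 0) :
    linearForm (toComplexVec α) ≠ 0 := fun h => by
  apply dotProduct_toComplexVec_self_ne_zero hα
  rw [← eval_linearForm, h, map_zero]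

theorem isHomogeneous_linearForm (a : Fin N → ℂ) : (linearForm a).IsHomogeneous 1 :=
  IsHomogeneous.sum _ _ _ fun i _ => isHomogeneous_C_mul_X _ i

/-- The reflection `s_α` acting on polynomials by `p ↦ p ∘ s_α`. -/
noncomputable def reflectPoly (α : EuclideanSpace ℝ (Fin N)) :
    MvPolynomial (Fin N) ℂ →ₐ[ℂ] MvPolynomial (Fin N) ℂ :=
  aeval fun i => X i - C (2 * toComplexVec α i / (toComplexVec α ⬝ᵥ toComplexVec α)) *
    linearForm (toComplexVec α)

theorem reflectPoly_X (α : EuclideanSpace ℝ (Fin N)) (i : Fin N) :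
    reflectPoly α (X i) = X i - C (2 * toComplexVec α i /
      (toComplexVec α ⬝ᵥ toComplexVec α)) * linearForm (toComplexVec α) := by
  rw [reflectPoly, aeval_X]

theorem reflectPoly_C (α : EuclideanSpace ℝ (Fin N)) (c : ℂ) :
    reflectPoly α (C c) = C c := (reflectPoly α).commutes c

theorem reflectPoly_C_mul (α : EuclideanSpace ℝ (Fin N)) (c : ℂ) (p : MvPolynomial (Fin N) ℂ) :
    reflectPoly α (C c * p) = C c * reflectPoly α p := by
  rw [map_mul, reflectPoly_C]

theorem eval_reflectPoly (α : EuclideanSpace ℝ (Fin N)) (p : MvPolynomial (Fin N) ℂ)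
    (z : Fin N → ℂ) : eval z (reflectPoly α p) = eval (complexReflection α z) p := by
  induction p using MvPolynomial.induction_on with
  | C a => rw [reflectPoly_C, eval_C, eval_C]
  | add p q hp hq => simp only [map_add, hp, hq]
  | mul_X p i hp =>
    rw [map_mul, map_mul, hp, reflectPoly_X, map_mul, eval_X, complexReflection_apply, map_sub,
      map_mul, eval_X, eval_C, eval_linearForm]

theorem isHomogeneous_reflectPoly (α : EuclideanSpace ℝ (Fin N)) {p : MvPolynomial (Fin N) ℂ}
    {n : ℕ} (hp : p.IsHomogeneous n) : (reflectPoly α p).IsHomogeneous n := by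
  have h := hp.aeval (n := 1) (fun i => X i - C (2 * toComplexVec α i /
    (toComplexVec α ⬝ᵥ toComplexVec α)) * linearForm (toComplexVec α)) fun i =>
      (isHomogeneous_X _ i).sub ((isHomogeneous_linearForm _).C_mul _)
  rwa [one_mul] at h

theorem linearForm_dvd_sub_reflectPoly (α : EuclideanSpace ℝ (Fin N))
    (p : MvPolynomial (Fin N) ℂ) :
    linearForm (toComplexVec α) ∣ p - reflectPoly α p := by
  induction p using MvPolynomial.induction_on with
  | C a => rw [reflectPoly_C, sub_self]; exact dvd_zero _
  | add p q hp hq => rw [map_add, add_sub_add_comm]; exact dvd_add hp hq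
  | mul_X p i hp =>
    obtain ⟨g, hg⟩ := hp
    refine ⟨g * X i + reflectPoly α p * C (2 * toComplexVec α i /
      (toComplexVec α ⬝ᵥ toComplexVec α)), ?_⟩
    rw [map_mul, reflectPoly_X]
    linear_combination X i * hg

/-- The divided difference `(p - s_α p) / (α · z)`, which is a polynomial. -/
noncomputable def dividedDiff (α : EuclideanSpace ℝ (Fin N)) (p : MvPolynomial (Fin N) ℂ) :
    MvPolynomial (Fin N) ℂ :=
  (linearForm_dvd_sub_reflectPoly α p).choose

theorem linearForm_mul_dividedDiff (α : EuclideanSpace ℝ (Fin N))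
    (p : MvPolynomial (Fin N) ℂ) :
    linearForm (toComplexVec α) * dividedDiff α p = p - reflectPoly α p :=
  (linearForm_dvd_sub_reflectPoly α p).choose_spec.symm

theorem dividedDiff_eq {α : EuclideanSpace ℝ (Fin N)} (hα : α ≠ 0)
    {p g : MvPolynomial (Fin N) ℂ}
    (h : linearForm (toComplexVec α) * g = p - reflectPoly α p) : dividedDiff α p = g :=
  mul_left_cancel₀ (linearForm_ne_zero hα) ((linearForm_mul_dividedDiff α p).trans h.symm)

theorem dividedDiff_add {α : EuclideanSpace ℝ (Fin N)} (hα : α ≠ 0)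
    (p q : MvPolynomial (Fin N) ℂ) :
    dividedDiff α (p + q) = dividedDiff α p + dividedDiff α q := by
  apply dividedDiff_eq hα
  rw [mul_add, linearForm_mul_dividedDiff, linearForm_mul_dividedDiff, map_add]
  ring

theorem dividedDiff_C {α : EuclideanSpace ℝ (Fin N)} (hα : α ≠ 0) (c : ℂ) :
    dividedDiff α (C c) = 0 := by
  apply dividedDiff_eq hα
  rw [reflectPoly_C]
  ring

theorem dividedDiff_C_mul {α : EuclideanSpace ℝ (Fin N)} (hα : α ≠ 0) (c : ℂ)
    (p : MvPolynomial (Fin N) ℂ) : dividedDiff α (C c * p) = C c * dividedDiff α p := by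
  apply dividedDiff_eq hα
  rw [map_mul, reflectPoly_C]
  linear_combination C c * linearForm_mul_dividedDiff α p

theorem dividedDiff_X_mul {α : EuclideanSpace ℝ (Fin N)} (hα : α ≠ 0) (i : Fin N)
    (p : MvPolynomial (Fin N) ℂ) :
    dividedDiff α (X i * p) = X i * dividedDiff α p + C (2 * toComplexVec α i /
      (toComplexVec α ⬝ᵥ toComplexVec α)) * reflectPoly α p := by
  apply dividedDiff_eq hα
  rw [map_mul, reflectPoly_X]
  linear_combination X i * linearForm_mul_dividedDiff α p

theorem dividedDiff_reflectPoly {α β : EuclideanSpace ℝ (Fin N)} (hα : α ≠ 0) (hβ : β ≠ 0)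
    (p : MvPolynomial (Fin N) ℂ) :
    dividedDiff β (reflectPoly α p) =
      reflectPoly α (dividedDiff ((Submodule.span ℝ {α})ᗮ.reflection β) p) := by
  apply dividedDiff_eq hβ
  have h := congrArg (reflectPoly α)
    (linearForm_mul_dividedDiff ((Submodule.span ℝ {α})ᗮ.reflection β) p)
  rw [map_mul, map_sub] at h
  have h1 : reflectPoly α (linearForm (toComplexVec ((Submodule.span ℝ {α})ᗮ.reflection β))) =
      linearForm (toComplexVec β) := by
    refine MvPolynomial.funext fun z => ?_
    rw [eval_reflectPoly, eval_linearForm, eval_linearForm, toComplexVec_reflection,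
      complexReflection_dotProduct_comm, complexReflection_complexReflection hα]
  have h2 : reflectPoly α (reflectPoly ((Submodule.span ℝ {α})ᗮ.reflection β) p) =
      reflectPoly β (reflectPoly α p) := by
    refine MvPolynomial.funext fun z => ?_
    simp only [eval_reflectPoly, complexReflection_reflection hα]
  rwa [h1, h2] at h

/-- The directional derivative `∂_ξ` on polynomials. -/
noncomputable def directionalDeriv (ξ : Fin N → ℂ) :
    Derivation ℂ (MvPolynomial (Fin N) ℂ) (MvPolynomial (Fin N) ℂ) :=
  mkDerivation ℂ fun i => C (ξ i)

theorem directionalDeriv_X (ξ : Fin N → ℂ) (i : Fin N) :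
    directionalDeriv ξ (X i) = C (ξ i) := mkDerivation_X _ _ _

theorem directionalDeriv_mul (ξ : Fin N → ℂ) (p q : MvPolynomial (Fin N) ℂ) :
    directionalDeriv ξ (p * q) = p * directionalDeriv ξ q + q * directionalDeriv ξ p :=
  Derivation.leibniz _ _ _

theorem directionalDeriv_linearForm (ξ a : Fin N → ℂ) :
    directionalDeriv ξ (linearForm a) = C (a ⬝ᵥ ξ) := by
  simp only [linearForm, map_sum, directionalDeriv_mul, directionalDeriv_X, derivation_C,
    mul_zero, add_zero, dotProduct, map_mul]

theorem directionalDeriv_reflectPoly (α : EuclideanSpace ℝ (Fin N)) (ξ : Fin N → ℂ)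
    (p : MvPolynomial (Fin N) ℂ) :
    directionalDeriv ξ (reflectPoly α p) =
      reflectPoly α (directionalDeriv (complexReflection α ξ) p) := by
  induction p using MvPolynomial.induction_on with
  | C a => rw [reflectPoly_C, derivation_C, derivation_C, map_zero]
  | add p q hp hq => simp only [map_add, hp, hq]
  | mul_X p i hp =>
    rw [map_mul, directionalDeriv_mul, directionalDeriv_mul, hp, map_add, map_mul, map_mul,
      reflectPoly_X, map_sub, directionalDeriv_mul, directionalDeriv_X, directionalDeriv_X,
      directionalDeriv_linearForm, derivation_C, reflectPoly_C, complexReflection_apply, C_sub,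
      C_mul]
    ring

theorem directionalDeriv_eq_sum (ξ : Fin N → ℂ) (p : MvPolynomial (Fin N) ℂ) :
    directionalDeriv ξ p = ∑ i, C (ξ i) * directionalDeriv (Pi.single i 1) p := by
  induction p using MvPolynomial.induction_on with
  | C a => simp only [derivation_C, mul_zero, Finset.sum_const_zero]
  | add p q hp hq => simp only [map_add, hp, hq, mul_add, Finset.sum_add_distrib]
  | mul_X p j hp =>
    simp only [directionalDeriv_mul, directionalDeriv_X, hp, mul_add, Finset.sum_add_distrib,
      Finset.mul_sum]
    congr 1
    · rw [Finset.sum_eq_single j]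
      · rw [Pi.single_eq_same, C_1]; ring
      · intro i _ hij
        rw [Pi.single_eq_of_ne hij.symm, C_0]; ring
      · simp
    · exact Finset.sum_congr rfl fun i _ => by ring

/-- The Euler operator `∑ z_i ∂_i` on polynomials. Homogeneity of the results of Dunkl operators is
expressed as an eigenvalue equation for it, which passes to divided differences by Leibniz' rule. -/
noncomputable def eulerDeriv (N : ℕ) :
    Derivation ℂ (MvPolynomial (Fin N) ℂ) (MvPolynomial (Fin N) ℂ) :=
  mkDerivation ℂ X

theorem eulerDeriv_X (i : Fin N) : eulerDeriv N (X i) = X i := mkDerivation_X _ _ _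

theorem eulerDeriv_mul (p q : MvPolynomial (Fin N) ℂ) :
    eulerDeriv N (p * q) = p * eulerDeriv N q + q * eulerDeriv N p := Derivation.leibniz _ _ _

theorem eulerDeriv_linearForm (a : Fin N → ℂ) : eulerDeriv N (linearForm a) = linearForm a := by
  simp only [linearForm, map_sum, eulerDeriv_mul, eulerDeriv_X, derivation_C, mul_zero, add_zero]

theorem eulerDeriv_eq_sum (p : MvPolynomial (Fin N) ℂ) :
    eulerDeriv N p = ∑ i, X i * directionalDeriv (Pi.single i 1) p := by
  induction p using MvPolynomial.induction_on with
  | C a => simp only [derivation_C, mul_zero, Finset.sum_const_zero]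
  | add p q hp hq => simp only [map_add, hp, hq, mul_add, Finset.sum_add_distrib]
  | mul_X p j hp =>
    simp only [directionalDeriv_mul, eulerDeriv_mul, eulerDeriv_X, directionalDeriv_X, hp,
      mul_add, Finset.sum_add_distrib, Finset.mul_sum]
    congr 1
    · rw [Finset.sum_eq_single j]
      · rw [Pi.single_eq_same, C_1]; ring
      · intro i _ hij
        rw [Pi.single_eq_of_ne hij.symm, C_0]; ring
      · simp
    · exact Finset.sum_congr rfl fun i _ => by ring

theorem eulerDeriv_of_isHomogeneous {p : MvPolynomial (Fin N) ℂ} {n : ℕ}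
    (hp : p.IsHomogeneous n) : eulerDeriv N p = C (n : ℂ) * p := by
  have h1 : ∀ i : Fin N, directionalDeriv (Pi.single i 1) p = pderiv i p := fun i => by
    have : directionalDeriv (Pi.single i 1) = pderiv (R := ℂ) i := by
      refine derivation_ext fun j => ?_
      rw [directionalDeriv_X, pderiv_X]
      rcases eq_or_ne j i with rfl | h
      · simp
      · rw [Pi.single_eq_of_ne h, Pi.single_eq_of_ne h, C_0]
    rw [this]
  rw [eulerDeriv_eq_sum]
  simp only [h1]
  rw [hp.sum_X_mul_pderiv, nsmul_eq_mul]
  simp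

theorem eulerDeriv_directionalDeriv {ξ : Fin N → ℂ} {p : MvPolynomial (Fin N) ℂ} {c : ℂ}
    (hp : eulerDeriv N p = C (c + 1) * p) :
    eulerDeriv N (directionalDeriv ξ p) = C c * directionalDeriv ξ p := by
  have h : ∀ q : MvPolynomial (Fin N) ℂ, eulerDeriv N (directionalDeriv ξ q) +
      directionalDeriv ξ q = directionalDeriv ξ (eulerDeriv N q) := by
    intro q
    induction q using MvPolynomial.induction_on with
    | C a => simp only [derivation_C, map_zero, add_zero]
    | add p q hp hq =>
      simp only [map_add, ← hp, ← hq]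
      ring
    | mul_X p i hp =>
      simp only [directionalDeriv_mul, eulerDeriv_mul, eulerDeriv_X, directionalDeriv_X, map_add,
        ← hp, derivation_C]
      ring
  have h1 := h p
  rw [hp, directionalDeriv_mul, derivation_C, C_add, C_1] at h1
  linear_combination h1

theorem eulerDeriv_reflectPoly (α : EuclideanSpace ℝ (Fin N)) (p : MvPolynomial (Fin N) ℂ) :
    eulerDeriv N (reflectPoly α p) = reflectPoly α (eulerDeriv N p) := by
  induction p using MvPolynomial.induction_on with
  | C a => rw [reflectPoly_C, derivation_C, map_zero]
  | add p q hp hq => simp only [map_add, hp, hq]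
  | mul_X p i hp =>
    simp only [map_mul, map_add, eulerDeriv_mul, hp, eulerDeriv_X, reflectPoly_X, map_sub,
      eulerDeriv_linearForm, derivation_C]
    ring

theorem eulerDeriv_dividedDiff {α : EuclideanSpace ℝ (Fin N)} (hα : α ≠ 0)
    {p : MvPolynomial (Fin N) ℂ} {c : ℂ} (hp : eulerDeriv N p = C (c + 1) * p) :
    eulerDeriv N (dividedDiff α p) = C c * dividedDiff α p := by
  apply mul_left_cancel₀ (linearForm_ne_zero hα)
  have h := congrArg (eulerDeriv N) (linearForm_mul_dividedDiff α p)
  rw [eulerDeriv_mul, map_sub, eulerDeriv_reflectPoly, hp, map_mul, reflectPoly_C,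
    eulerDeriv_linearForm, C_add, C_1] at h
  linear_combination h - (C c + 1) * linearForm_mul_dividedDiff α p

/-- The Dunkl operator `T_ξ` on polynomials. -/
noncomputable def dunklPoly (R : Finset (EuclideanSpace ℝ (Fin N)))
    (μ : EuclideanSpace ℝ (Fin N) → ℝ)
    (ξ : Fin N → ℂ) (p : MvPolynomial (Fin N) ℂ) : MvPolynomial (Fin N) ℂ :=
  directionalDeriv ξ p + C (1 / 2) * ∑ α ∈ R, C ((μ α : ℂ) * (toComplexVec α ⬝ᵥ ξ)) *
    dividedDiff α p

variable {R : Finset (EuclideanSpace ℝ (Fin N))} {μ : EuclideanSpace ℝ (Fin N) → ℝ}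

theorem IsRootSystem.ne_zero (hR : IsRootSystem R) {α : EuclideanSpace ℝ (Fin N)}
    (hα : α ∈ R) : α ≠ 0 := fun h => hR.zero_notMem (h ▸ hα)

theorem dunklPoly_add (hR : IsRootSystem R) (ξ : Fin N → ℂ) (p q : MvPolynomial (Fin N) ℂ) :
    dunklPoly R μ ξ (p + q) = dunklPoly R μ ξ p + dunklPoly R μ ξ q := by
  have h : ∀ α ∈ R, C ((μ α : ℂ) * (toComplexVec α ⬝ᵥ ξ)) * dividedDiff α (p + q) =
      C ((μ α : ℂ) * (toComplexVec α ⬝ᵥ ξ)) * dividedDiff α p +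
      C ((μ α : ℂ) * (toComplexVec α ⬝ᵥ ξ)) * dividedDiff α q := fun α hα => by
    rw [dividedDiff_add (hR.ne_zero hα), mul_add]
  rw [dunklPoly, Finset.sum_congr rfl h, Finset.sum_add_distrib, map_add, dunklPoly, dunklPoly]
  ring

theorem dunklPoly_C (hR : IsRootSystem R) (ξ : Fin N → ℂ) (c : ℂ) :
    dunklPoly R μ ξ (C c) = 0 := by
  rw [dunklPoly, derivation_C, Finset.sum_eq_zero, mul_zero, add_zero]
  intro α hα
  rw [dividedDiff_C (hR.ne_zero hα), mul_zero]

theorem dunklPoly_C_mul (hR : IsRootSystem R) (ξ : Fin N → ℂ) (c : ℂ)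
    (p : MvPolynomial (Fin N) ℂ) :
    dunklPoly R μ ξ (C c * p) = C c * dunklPoly R μ ξ p := by
  have h : ∀ α ∈ R, C ((μ α : ℂ) * (toComplexVec α ⬝ᵥ ξ)) * dividedDiff α (C c * p) =
      C c * (C ((μ α : ℂ) * (toComplexVec α ⬝ᵥ ξ)) * dividedDiff α p) := fun α hα => by
    rw [dividedDiff_C_mul (hR.ne_zero hα)]
    ring
  rw [dunklPoly, Finset.sum_congr rfl h, ← Finset.mul_sum, directionalDeriv_mul, derivation_C,
    dunklPoly]
  ring

theorem dunklPoly_sum (hR : IsRootSystem R) (ξ : Fin N → ℂ) {ι : Type*} (s : Finset ι)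
    (p : ι → MvPolynomial (Fin N) ℂ) :
    dunklPoly R μ ξ (∑ i ∈ s, p i) = ∑ i ∈ s, dunklPoly R μ ξ (p i) :=
  map_sum (AddMonoidHom.mk' (dunklPoly R μ ξ) (dunklPoly_add hR ξ)) p s

theorem dunklPoly_eq_sum (ξ : Fin N → ℂ) (p : MvPolynomial (Fin N) ℂ) :
    dunklPoly R μ ξ p = ∑ i, C (ξ i) * dunklPoly R μ (Pi.single i 1) p := by
  simp only [dunklPoly, mul_add, Finset.sum_add_distrib]
  rw [← directionalDeriv_eq_sum]
  congr 1
  simp only [Finset.mul_sum]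
  rw [Finset.sum_comm]
  refine Finset.sum_congr rfl fun α _ => ?_
  simp only [dotProduct_single, mul_one, C_mul]
  simp only [dotProduct, map_sum, Finset.mul_sum, Finset.sum_mul, C_mul]
  exact Finset.sum_congr rfl fun i _ => by ring

theorem dunklPoly_X_mul (hR : IsRootSystem R) (ξ : Fin N → ℂ) (i : Fin N)
    (p : MvPolynomial (Fin N) ℂ) :
    dunklPoly R μ ξ (X i * p) = X i * dunklPoly R μ ξ p + C (ξ i) * p +
      C (1 / 2) * ∑ α ∈ R, C ((μ α : ℂ) * (toComplexVec α ⬝ᵥ ξ) * (2 * toComplexVec α i /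
        (toComplexVec α ⬝ᵥ toComplexVec α))) * reflectPoly α p := by
  have h : ∀ α ∈ R, C ((μ α : ℂ) * (toComplexVec α ⬝ᵥ ξ)) * dividedDiff α (X i * p) =
      X i * (C ((μ α : ℂ) * (toComplexVec α ⬝ᵥ ξ)) * dividedDiff α p) +
      C ((μ α : ℂ) * (toComplexVec α ⬝ᵥ ξ) * (2 * toComplexVec α i /
        (toComplexVec α ⬝ᵥ toComplexVec α))) * reflectPoly α p := fun α hα => by
    rw [dividedDiff_X_mul (hR.ne_zero hα), C_mul (a := (μ α : ℂ) * _)]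
    ring
  rw [dunklPoly, Finset.sum_congr rfl h, Finset.sum_add_distrib, ← Finset.mul_sum,
    directionalDeriv_mul, directionalDeriv_X, dunklPoly]
  ring

theorem dunklPoly_linearForm_mul (hR : IsRootSystem R) (ξ w : Fin N → ℂ)
    (p : MvPolynomial (Fin N) ℂ) :
    dunklPoly R μ ξ (linearForm w * p) = linearForm w * dunklPoly R μ ξ p + C (ξ ⬝ᵥ w) * p +
      C (1 / 2) * ∑ α ∈ R, C ((μ α : ℂ) * (toComplexVec α ⬝ᵥ ξ) * (2 * (toComplexVec α ⬝ᵥ w) /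
        (toComplexVec α ⬝ᵥ toComplexVec α))) * reflectPoly α p := by
  have h : linearForm w * p = ∑ i, C (w i) * (X i * p) := by
    rw [linearForm, Finset.sum_mul]
    exact Finset.sum_congr rfl fun i _ => mul_assoc _ _ _
  rw [h, dunklPoly_sum hR]
  simp only [dunklPoly_C_mul hR, dunklPoly_X_mul hR, mul_add, Finset.sum_add_distrib]
  congr 1
  · congr 1
    · rw [linearForm, Finset.sum_mul]
      exact Finset.sum_congr rfl fun i _ => by ring
    · simp only [dotProduct, map_sum, Finset.sum_mul, C_mul]
      exact Finset.sum_congr rfl fun i _ => by ring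
  · simp only [Finset.mul_sum]
    rw [Finset.sum_comm]
    refine Finset.sum_congr rfl fun α _ => ?_
    have h2 : (μ α : ℂ) * (toComplexVec α ⬝ᵥ ξ) * (2 * (toComplexVec α ⬝ᵥ w) /
        (toComplexVec α ⬝ᵥ toComplexVec α)) = ∑ i, w i * ((μ α : ℂ) * (toComplexVec α ⬝ᵥ ξ) *
          (2 * toComplexVec α i / (toComplexVec α ⬝ᵥ toComplexVec α))) := by
      conv_lhs => rw [dotProduct.eq_1 (toComplexVec α) w]
      rw [Finset.mul_sum, Finset.sum_div, Finset.mul_sum]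
      exact Finset.sum_congr rfl fun i _ => by ring
    rw [h2, map_sum, Finset.sum_mul, Finset.mul_sum]
    refine Finset.sum_congr rfl fun i _ => ?_
    rw [C_mul (a := w i)]
    ring

theorem dunklPoly_complexReflection (α : EuclideanSpace ℝ (Fin N)) (ξ : Fin N → ℂ)
    (p : MvPolynomial (Fin N) ℂ) :
    dunklPoly R μ (complexReflection α ξ) p = dunklPoly R μ ξ p -
      C (2 * (toComplexVec α ⬝ᵥ ξ) / (toComplexVec α ⬝ᵥ toComplexVec α)) *
        dunklPoly R μ (toComplexVec α) p := by
  rw [dunklPoly_eq_sum (complexReflection α ξ), dunklPoly_eq_sum ξ,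
    dunklPoly_eq_sum (toComplexVec α), Finset.mul_sum, ← Finset.sum_sub_distrib]
  refine Finset.sum_congr rfl fun i _ => ?_
  rw [← mul_assoc, ← sub_mul, ← C_mul, ← C_sub, complexReflection_apply]
  congr 2
  ring

/-- Equivariance of the Dunkl operators, `T_ξ s_α = s_α T_{s_α ξ}`. -/
theorem dunklPoly_reflectPoly (hR : IsRootSystem R) (hμ : IsMultiplicityFunction R μ)
    {α : EuclideanSpace ℝ (Fin N)} (hα : α ∈ R) (ξ : Fin N → ℂ) (p : MvPolynomial (Fin N) ℂ) :
    dunklPoly R μ ξ (reflectPoly α p) =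
      reflectPoly α (dunklPoly R μ (complexReflection α ξ) p) := by
  rw [dunklPoly, dunklPoly, directionalDeriv_reflectPoly, map_add, map_mul, reflectPoly_C,
    map_sum]
  congr 2
  have hmem : ∀ β ∈ R, (Submodule.span ℝ {α})ᗮ.reflection β ∈ R := hR.reflection_mem α hα
  refine Finset.sum_bij' (fun β _ => (Submodule.span ℝ {α})ᗮ.reflection β)
    (fun β _ => (Submodule.span ℝ {α})ᗮ.reflection β) hmem hmem ?_ ?_ ?_
  · intro β _
    exact Submodule.reflection_reflection _ β
  · intro β _
    exact Submodule.reflection_reflection _ β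
  · intro β hβ
    rw [reflectPoly_C_mul, toComplexVec_reflection, complexReflection_dotProduct_comm,
      complexReflection_complexReflection (hR.ne_zero hα),
      hμ.invariant _ (Subgroup.subset_closure ⟨α, hα, rfl⟩) β hβ,
      dividedDiff_reflectPoly (hR.ne_zero hα) (hR.ne_zero hβ)]

/-- Dunkl operators commute. Both sides agree on constants, and the commutator `[T_ξ, T_η]`
commutes with multiplication by each coordinate: by the Jacobi identity
`[[T_ξ, T_η], z_i] = [[T_ξ, z_i], T_η] - [[T_η, z_i], T_ξ]`, and the right-hand side vanishes because
`[[T_ξ, z_i], T_η]` is a sum of multiples of `α_i (α·ξ) (α·η) s_α T_α`, symmetric in `ξ` and `η`. -/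
theorem dunklPoly_comm (hR : IsRootSystem R) (hμ : IsMultiplicityFunction R μ)
    (ξ η : Fin N → ℂ) (p : MvPolynomial (Fin N) ℂ) :
    dunklPoly R μ ξ (dunklPoly R μ η p) = dunklPoly R μ η (dunklPoly R μ ξ p) := by
  induction p using MvPolynomial.induction_on with
  | C a => rw [dunklPoly_C hR, dunklPoly_C hR, ← C_0, dunklPoly_C hR, dunklPoly_C hR]
  | add p q hp hq => simp only [dunklPoly_add hR, hp, hq]
  | mul_X p i hp =>
    have key : ∀ ξ η : Fin N → ℂ, dunklPoly R μ ξ (dunklPoly R μ η (p * X i)) =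
        X i * dunklPoly R μ ξ (dunklPoly R μ η p) + C (ξ i) * dunklPoly R μ η p +
        C (η i) * dunklPoly R μ ξ p + C (1 / 2) * ∑ α ∈ R,
          (C ((μ α : ℂ) * (toComplexVec α ⬝ᵥ ξ) * (2 * toComplexVec α i /
            (toComplexVec α ⬝ᵥ toComplexVec α))) * reflectPoly α (dunklPoly R μ η p) +
          C ((μ α : ℂ) * (toComplexVec α ⬝ᵥ η) * (2 * toComplexVec α i /
            (toComplexVec α ⬝ᵥ toComplexVec α))) * (reflectPoly α (dunklPoly R μ ξ p) -
            C (2 * (toComplexVec α ⬝ᵥ ξ) / (toComplexVec α ⬝ᵥ toComplexVec α)) *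
              reflectPoly α (dunklPoly R μ (toComplexVec α) p))) := by
      intro ξ η
      rw [mul_comm p, dunklPoly_X_mul hR, dunklPoly_add hR, dunklPoly_add hR, dunklPoly_X_mul hR,
        dunklPoly_C_mul hR, dunklPoly_C_mul hR, dunklPoly_sum hR, Finset.sum_add_distrib]
      have h : ∀ α ∈ R, dunklPoly R μ ξ (C ((μ α : ℂ) * (toComplexVec α ⬝ᵥ η) *
          (2 * toComplexVec α i / (toComplexVec α ⬝ᵥ toComplexVec α))) * reflectPoly α p) =
          C ((μ α : ℂ) * (toComplexVec α ⬝ᵥ η) * (2 * toComplexVec α i /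
            (toComplexVec α ⬝ᵥ toComplexVec α))) * (reflectPoly α (dunklPoly R μ ξ p) -
            C (2 * (toComplexVec α ⬝ᵥ ξ) / (toComplexVec α ⬝ᵥ toComplexVec α)) *
              reflectPoly α (dunklPoly R μ (toComplexVec α) p)) := by
        intro α hα
        rw [dunklPoly_C_mul hR, dunklPoly_reflectPoly hR hμ hα, dunklPoly_complexReflection,
          map_sub, reflectPoly_C_mul]
      rw [Finset.sum_congr rfl h]
      ring
    rw [key ξ η, key η ξ, hp]
    have hs : ∀ α ∈ R, C ((μ α : ℂ) * (toComplexVec α ⬝ᵥ ξ) * (2 * toComplexVec α i /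
            (toComplexVec α ⬝ᵥ toComplexVec α))) * reflectPoly α (dunklPoly R μ η p) +
          C ((μ α : ℂ) * (toComplexVec α ⬝ᵥ η) * (2 * toComplexVec α i /
            (toComplexVec α ⬝ᵥ toComplexVec α))) * (reflectPoly α (dunklPoly R μ ξ p) -
            C (2 * (toComplexVec α ⬝ᵥ ξ) / (toComplexVec α ⬝ᵥ toComplexVec α)) *
              reflectPoly α (dunklPoly R μ (toComplexVec α) p)) =
        C ((μ α : ℂ) * (toComplexVec α ⬝ᵥ η) * (2 * toComplexVec α i /
            (toComplexVec α ⬝ᵥ toComplexVec α))) * reflectPoly α (dunklPoly R μ ξ p) +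
          C ((μ α : ℂ) * (toComplexVec α ⬝ᵥ ξ) * (2 * toComplexVec α i /
            (toComplexVec α ⬝ᵥ toComplexVec α))) * (reflectPoly α (dunklPoly R μ η p) -
            C (2 * (toComplexVec α ⬝ᵥ η) / (toComplexVec α ⬝ᵥ toComplexVec α)) *
              reflectPoly α (dunklPoly R μ (toComplexVec α) p)) := by
      intro α _
      simp only [div_eq_mul_inv, C_mul]
      ring
    rw [Finset.sum_congr rfl hs]
    ring

/-- The Dunkl analogue of the Euler operator: `∑ z_i T_i = ∑ z_i ∂_i + ½ ∑ μ(α) (1 - s_α)`. -/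
theorem sum_X_mul_dunklPoly (p : MvPolynomial (Fin N) ℂ) :
    ∑ i, X i * dunklPoly R μ (Pi.single i 1) p =
      eulerDeriv N p + C (1 / 2) * ∑ α ∈ R, C (μ α : ℂ) * (p - reflectPoly α p) := by
  simp only [dunklPoly, mul_add, Finset.sum_add_distrib]
  rw [← eulerDeriv_eq_sum]
  congr 1
  simp only [Finset.mul_sum]
  rw [Finset.sum_comm]
  refine Finset.sum_congr rfl fun α _ => ?_
  rw [← linearForm_mul_dividedDiff, linearForm]
  simp only [Finset.mul_sum, Finset.sum_mul]
  refine Finset.sum_congr rfl fun i _ => ?_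
  rw [dotProduct_single, mul_one, C_mul]
  ring

theorem eulerDeriv_dunklPoly (hR : IsRootSystem R) (ξ : Fin N → ℂ)
    {p : MvPolynomial (Fin N) ℂ} {c : ℂ} (hp : eulerDeriv N p = C (c + 1) * p) :
    eulerDeriv N (dunklPoly R μ ξ p) = C c * dunklPoly R μ ξ p := by
  have h : ∀ α ∈ R, eulerDeriv N (C ((μ α : ℂ) * (toComplexVec α ⬝ᵥ ξ)) * dividedDiff α p) =
      C c * (C ((μ α : ℂ) * (toComplexVec α ⬝ᵥ ξ)) * dividedDiff α p) := fun α hα => by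
    rw [eulerDeriv_mul, derivation_C, eulerDeriv_dividedDiff (hR.ne_zero hα) hp]
    ring
  rw [dunklPoly, map_add, eulerDeriv_mul, derivation_C, map_sum, Finset.sum_congr rfl h,
    eulerDeriv_directionalDeriv hp, ← Finset.mul_sum]
  ring

/-- The commutator of `T_ξ` with `∑ z_i T_i`. -/
theorem dunklPoly_sum_X_mul_dunklPoly (hR : IsRootSystem R) (hμ : IsMultiplicityFunction R μ)
    (ξ : Fin N → ℂ) (p : MvPolynomial (Fin N) ℂ) :
    dunklPoly R μ ξ (∑ i, X i * dunklPoly R μ (Pi.single i 1) p) =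
      ∑ i, X i * dunklPoly R μ (Pi.single i 1) (dunklPoly R μ ξ p) + dunklPoly R μ ξ p +
      C (1 / 2) * ∑ α ∈ R, C ((μ α : ℂ) * (2 * (toComplexVec α ⬝ᵥ ξ) /
        (toComplexVec α ⬝ᵥ toComplexVec α))) *
          reflectPoly α (dunklPoly R μ (toComplexVec α) p) := by
  have h1 : ∀ i, X i * dunklPoly R μ ξ (dunklPoly R μ (Pi.single i 1) p) =
      X i * dunklPoly R μ (Pi.single i 1) (dunklPoly R μ ξ p) := fun i => by
    rw [dunklPoly_comm hR hμ]
  have h2 : ∀ α ∈ R, ∑ i, C ((μ α : ℂ) * (toComplexVec α ⬝ᵥ ξ) * (2 * toComplexVec α i /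
        (toComplexVec α ⬝ᵥ toComplexVec α))) *
          reflectPoly α (dunklPoly R μ (Pi.single i 1) p) =
      C ((μ α : ℂ) * (2 * (toComplexVec α ⬝ᵥ ξ) / (toComplexVec α ⬝ᵥ toComplexVec α))) *
        reflectPoly α (dunklPoly R μ (toComplexVec α) p) := fun α _ => by
    rw [dunklPoly_eq_sum (toComplexVec α), map_sum, Finset.mul_sum]
    refine Finset.sum_congr rfl fun i _ => ?_
    rw [reflectPoly_C_mul, ← mul_assoc, ← C_mul]
    congr 2
    ring
  rw [dunklPoly_sum hR]
  simp only [dunklPoly_X_mul hR, Finset.sum_add_distrib]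
  rw [← dunklPoly_eq_sum, ← Finset.mul_sum, Finset.sum_comm, Finset.sum_congr rfl h2]
  simp only [h1]

/-! ### Existence of the Dunkl kernel -/

theorem IsRootSystem.mapsTo_hermitianBall (hR : IsRootSystem R) (r : ℝ) :
    ∀ α ∈ R, Set.MapsTo (complexReflection α) (hermitianBall N r) (hermitianBall N r) :=
  fun _ hα => mapsTo_complexReflection_hermitianBall (hR.ne_zero hα) r

theorem eval_average (c : ℂ) (p : MvPolynomial (Fin N) ℂ) (z : Fin N → ℂ) :
    eval z (C c * p + C (1 / 2) * ∑ α ∈ R, C (μ α : ℂ) * (p - reflectPoly α p)) =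
      c * eval z p + 1 / 2 * ∑ α ∈ R, (μ α : ℂ) *
        (eval z p - eval (complexReflection α z) p) := by
  simp only [map_add, map_mul, eval_C, map_sum, map_sub, eval_reflectPoly]

/-- The operator `c + ½ ∑ μ(α) (1 - s_α)`, `c > 0`, maps homogeneous polynomials of each degree onto
homogeneous polynomials of that degree: on these finite-dimensional spaces it is injective by the
maximum principle. -/
theorem exists_isHomogeneous_average_eq (hR : IsRootSystem R) (hμ : IsMultiplicityFunction R μ)
    {c : ℝ} (hc : 0 < c) {n : ℕ} {q : MvPolynomial (Fin N) ℂ} (hq : q.IsHomogeneous n) :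
    ∃ g : MvPolynomial (Fin N) ℂ, g.IsHomogeneous n ∧
      C (c : ℂ) * g + C (1 / 2) * ∑ α ∈ R, C (μ α : ℂ) * (g - reflectPoly α g) = q := by
  have : FiniteDimensional ℂ (homogeneousSubmodule (Fin N) ℂ n) :=
    Module.Finite.iff_fg.2 (homogeneousSubmodule_fg _ _ n)
  let A : MvPolynomial (Fin N) ℂ →ₗ[ℂ] MvPolynomial (Fin N) ℂ :=
    (c : ℂ) • LinearMap.id + (1 / 2 : ℂ) • ∑ α ∈ R, (μ α : ℂ) •
      (LinearMap.id - (reflectPoly α).toLinearMap)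
  have hA : ∀ g, A g = C (c : ℂ) * g +
      C (1 / 2) * ∑ α ∈ R, C (μ α : ℂ) * (g - reflectPoly α g) := by
    intro g
    simp [A, C_mul', LinearMap.sum_apply]
  have hmaps : ∀ g ∈ homogeneousSubmodule (Fin N) ℂ n, A g ∈ homogeneousSubmodule (Fin N) ℂ n := by
    intro g hg
    rw [mem_homogeneousSubmodule] at hg ⊢
    rw [hA]
    exact (hg.C_mul _).add (IsHomogeneous.C_mul (IsHomogeneous.sum _ _ _ fun α _ =>
      (hg.sub (isHomogeneous_reflectPoly α hg)).C_mul _) _)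
  have hinj : Function.Injective (A.restrict hmaps) := by
    rw [injective_iff_map_eq_zero]
    rintro ⟨g, hg⟩ h0
    have h1 : A g = 0 := congrArg Subtype.val h0
    ext1
    refine MvPolynomial.funext fun z => ?_
    obtain ⟨r, hz, -⟩ := exists_mem_hermitianBall z z
    have h2 := norm_le_div_of_norm_averaging_le (isCompact_hermitianBall r) R μ hμ.nonneg
      complexReflection (hR.mapsTo_hermitianBall r) (H := fun z => eval z g)
      (MvPolynomial.continuous_eval g).continuousOn hc (M := 0) (fun x _ => by
        rw [← eval_average, ← hA, h1, map_zero, norm_zero]) z hz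
    simpa using h2
  obtain ⟨g, hg⟩ := LinearMap.surjective_of_injective hinj ⟨q, hq⟩
  exact ⟨g, g.2, by rw [← hA]; exact congrArg Subtype.val hg⟩

/-- `F` is the sequence of homogeneous components of a normalized solution of the radial part
`(∑ z_i T_i) f = (w·z) f` of the eigenvalue equation. -/
structure IsRadialSequence (R : Finset (EuclideanSpace ℝ (Fin N)))
    (μ : EuclideanSpace ℝ (Fin N) → ℝ) (w : Fin N → ℂ) (F : ℕ → MvPolynomial (Fin N) ℂ) :
    Prop where
  zero : F 0 = 1
  isHomogeneous : ∀ n, (F n).IsHomogeneous n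
  radial : ∀ n : ℕ, C ((n + 1 : ℝ) : ℂ) * F (n + 1) + C (1 / 2) *
    ∑ α ∈ R, C (μ α : ℂ) * (F (n + 1) - reflectPoly α (F (n + 1))) = linearForm w * F n

theorem exists_isRadialSequence (hR : IsRootSystem R) (hμ : IsMultiplicityFunction R μ)
    (w : Fin N → ℂ) : ∃ F, IsRadialSequence R μ w F := by
  have step : ∀ (n : ℕ) (p : {p : MvPolynomial (Fin N) ℂ // p.IsHomogeneous n}),
      ∃ g : {p : MvPolynomial (Fin N) ℂ // p.IsHomogeneous (n + 1)},
        C ((n + 1 : ℝ) : ℂ) * g.1 + C (1 / 2) *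
          ∑ α ∈ R, C (μ α : ℂ) * (g.1 - reflectPoly α g.1) = linearForm w * p.1 := by
    intro n p
    have hq : (linearForm w * p.1).IsHomogeneous (n + 1) := by
      rw [add_comm]
      exact (isHomogeneous_linearForm w).mul p.2
    obtain ⟨g, hg, h⟩ := exists_isHomogeneous_average_eq hR hμ
      (by positivity : (0 : ℝ) < n + 1) hq
    exact ⟨⟨g, hg⟩, h⟩
  choose g hg using step
  let F : ∀ n, {p : MvPolynomial (Fin N) ℂ // p.IsHomogeneous n} := fun n =>
    Nat.rec ⟨1, isHomogeneous_one _ _⟩ (fun n p => g n p) n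
  exact ⟨fun n => (F n).1, rfl, fun n => (F n).2, fun n => hg n (F n)⟩

/-- A homogeneous solution of the radial equation solves the full eigenvalue equation, provided the
previous component does. The defect `h_ξ = T_ξ g - (ξ·w) p` satisfies
`(n + 1) h_ξ + ½ ∑ μ(α) (h_ξ - s_α h_{s_α ξ}) = 0`, because the Dunkl operators commute, so it
vanishes by the maximum principle on pairs `(ξ, z)`. -/
theorem dunklPoly_eq_of_radial (hR : IsRootSystem R) (hμ : IsMultiplicityFunction R μ)
    {w : Fin N → ℂ} {n : ℕ} {p' p g : MvPolynomial (Fin N) ℂ} (hp : p.IsHomogeneous n)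
    (hg : g.IsHomogeneous (n + 1))
    (hp' : ∀ ξ, dunklPoly R μ ξ p = C (ξ ⬝ᵥ w) * p')
    (hgp : C ((n + 1 : ℝ) : ℂ) * g + C (1 / 2) *
      ∑ α ∈ R, C (μ α : ℂ) * (g - reflectPoly α g) = linearForm w * p) (ξ : Fin N → ℂ) :
    dunklPoly R μ ξ g = C (ξ ⬝ᵥ w) * p := by
  set h : (Fin N → ℂ) → MvPolynomial (Fin N) ℂ := fun ξ => dunklPoly R μ ξ g - C (ξ ⬝ᵥ w) * p
    with h_def
  have hEg : eulerDeriv N g = C ((n : ℂ) + 1) * g := by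
    rw [eulerDeriv_of_isHomogeneous hg]
    push_cast
    rfl
  have hEp : eulerDeriv N p = C (n : ℂ) * p := eulerDeriv_of_isHomogeneous hp
  have hDg : ∑ i, X i * dunklPoly R μ (Pi.single i 1) g = linearForm w * p := by
    rw [sum_X_mul_dunklPoly, hEg, ← hgp]
    push_cast
    rfl
  have hDp : ∑ i, X i * dunklPoly R μ (Pi.single i 1) p = linearForm w * p' := by
    simp only [hp', linearForm, Finset.sum_mul, single_dotProduct, one_mul]
    exact Finset.sum_congr rfl fun i _ => by ring
  have hrefl : ∀ α ξ, h (complexReflection α ξ) = h ξ - C (2 * (toComplexVec α ⬝ᵥ ξ) /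
      (toComplexVec α ⬝ᵥ toComplexVec α)) * h (toComplexVec α) := by
    intro α ξ
    simp only [h_def, dunklPoly_complexReflection, dotProduct_complexReflection_left, C_sub, C_mul]
    ring
  have hsum : ∀ ξ, h ξ = ∑ i, C (ξ i) * h (Pi.single i 1) := by
    intro ξ
    simp only [h_def, single_dotProduct, one_mul]
    rw [dunklPoly_eq_sum, dotProduct, map_sum, Finset.sum_mul, ← Finset.sum_sub_distrib]
    exact Finset.sum_congr rfl fun i _ => by rw [C_mul]; ring
  have hEh : ∀ ξ, eulerDeriv N (h ξ) = C (n : ℂ) * h ξ := by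
    intro ξ
    simp only [h_def]
    rw [map_sub, eulerDeriv_dunklPoly hR ξ hEg, eulerDeriv_mul, derivation_C, hEp]
    ring
  -- Apply `T_ξ` to the radial equation `(∑ z_i T_i) g = (w·z) p` and commute it past both sides.
  have hav : ∀ ξ, C ((n + 1 : ℝ) : ℂ) * h ξ + C (1 / 2) *
      ∑ α ∈ R, C (μ α : ℂ) * (h ξ - reflectPoly α (h (complexReflection α ξ))) = 0 := by
    intro ξ
    have e1 := dunklPoly_sum_X_mul_dunklPoly hR hμ ξ g
    have e2 : dunklPoly R μ ξ g = h ξ + C (ξ ⬝ᵥ w) * p := by rw [h_def]; ring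
    have e3 : ∑ i, X i * dunklPoly R μ (Pi.single i 1) (dunklPoly R μ ξ g) =
        C (n : ℂ) * h ξ + C (1 / 2) * ∑ α ∈ R, C (μ α : ℂ) * (h ξ - reflectPoly α (h ξ)) +
          C (ξ ⬝ᵥ w) * (linearForm w * p') := by
      rw [e2, ← hEh, ← sum_X_mul_dunklPoly, ← hDp, Finset.mul_sum, ← Finset.sum_add_distrib]
      refine Finset.sum_congr rfl fun i _ => ?_
      rw [dunklPoly_add hR, dunklPoly_C_mul hR]
      ring
    rw [hDg, dunklPoly_linearForm_mul hR, e3, e2, hp'] at e1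
    have e4 : ∀ α ∈ R, C (μ α : ℂ) * (h ξ - reflectPoly α (h (complexReflection α ξ))) =
        C (μ α : ℂ) * (h ξ - reflectPoly α (h ξ)) +
        (C ((μ α : ℂ) * (2 * (toComplexVec α ⬝ᵥ ξ) / (toComplexVec α ⬝ᵥ toComplexVec α))) *
            reflectPoly α (dunklPoly R μ (toComplexVec α) g) -
          C ((μ α : ℂ) * (toComplexVec α ⬝ᵥ ξ) * (2 * (toComplexVec α ⬝ᵥ w) /
            (toComplexVec α ⬝ᵥ toComplexVec α))) * reflectPoly α p) := by
      intro α _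
      rw [hrefl, map_sub, reflectPoly_C_mul]
      simp only [h_def, map_sub, reflectPoly_C_mul, div_eq_mul_inv, C_mul]
      ring
    rw [Finset.sum_congr rfl e4, Finset.sum_add_distrib, Finset.sum_sub_distrib]
    push_cast
    rw [C_add, C_1]
    linear_combination -e1
  suffices hz : h ξ = 0 from sub_eq_zero.1 hz
  refine MvPolynomial.funext fun z => ?_
  obtain ⟨r, hξ, hz⟩ := exists_mem_hermitianBall ξ z
  have hcont : Continuous fun x : (Fin N → ℂ) × (Fin N → ℂ) => eval x.2 (h x.1) := by
    have : (fun x : (Fin N → ℂ) × (Fin N → ℂ) => eval x.2 (h x.1)) =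
        fun x => ∑ i, x.1 i * eval x.2 (h (Pi.single i 1)) := by
      funext x
      rw [hsum]
      simp only [map_sum, map_mul, eval_C]
    rw [this]
    refine continuous_finsetSum _ fun i _ => ?_
    exact ((continuous_apply i).comp continuous_fst).mul
      ((MvPolynomial.continuous_eval _).comp continuous_snd)
  have key := norm_le_div_of_norm_averaging_le
    ((isCompact_hermitianBall r).prod (isCompact_hermitianBall r)) R μ hμ.nonneg
    (fun α x => (complexReflection α x.1, complexReflection α x.2))
    (fun α hα x hx => ⟨hR.mapsTo_hermitianBall r α hα hx.1, hR.mapsTo_hermitianBall r α hα hx.2⟩)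
    (H := fun x => eval x.2 (h x.1)) hcont.continuousOn (c := n + 1) (by positivity) (M := 0)
    (fun x _ => by
      have := congrArg (eval x.2) (hav x.1)
      simp only [map_add, map_mul, eval_C, map_sum, map_sub, eval_reflectPoly, map_zero] at this
      rw [this, norm_zero]) (ξ, z) ⟨hξ, hz⟩
  simpa using key

/-- The eigenvalue equation for all homogeneous components of the Dunkl kernel. -/
theorem IsRadialSequence.dunklPoly_succ (hR : IsRootSystem R) (hμ : IsMultiplicityFunction R μ)
    {w : Fin N → ℂ} {F : ℕ → MvPolynomial (Fin N) ℂ} (hF : IsRadialSequence R μ w F) (n : ℕ) :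
    ∀ ξ, dunklPoly R μ ξ (F (n + 1)) = C (ξ ⬝ᵥ w) * F n := by
  induction n with
  | zero =>
    refine dunklPoly_eq_of_radial hR hμ (hF.isHomogeneous 0) (hF.isHomogeneous 1) (p' := 0)
      (fun ξ => ?_) (hF.radial 0)
    rw [hF.zero, ← C_1, dunklPoly_C hR, mul_zero]
  | succ n ih =>
    exact dunklPoly_eq_of_radial hR hμ (hF.isHomogeneous _) (hF.isHomogeneous _) ih (hF.radial _)

theorem IsRadialSequence.exists_norm_eval_le (hR : IsRootSystem R)
    (hμ : IsMultiplicityFunction R μ)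
    {w : Fin N → ℂ} {F : ℕ → MvPolynomial (Fin N) ℂ} (hF : IsRadialSequence R μ w F) (r : ℝ) :
    ∃ B : ℝ, ∀ n, ∀ z ∈ hermitianBall N r, ‖eval z (F n)‖ ≤ B ^ n / n.factorial := by
  obtain ⟨B, hB⟩ := (isCompact_hermitianBall (N := N) r).exists_bound_of_continuousOn
    (f := fun z => w ⬝ᵥ z) (by unfold dotProduct; fun_prop)
  refine ⟨B, fun n => ?_⟩
  induction n with
  | zero => intro z _; simp [hF.zero]
  | succ n ih =>
    intro z hz
    refine (norm_le_div_of_norm_averaging_le (isCompact_hermitianBall r) R μ hμ.nonneg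
      complexReflection (hR.mapsTo_hermitianBall r) (H := fun z => eval z (F (n + 1)))
      (MvPolynomial.continuous_eval _).continuousOn (c := n + 1) (by positivity)
      (M := B * (B ^ n / n.factorial)) (fun x hx => ?_) z hz).trans (le_of_eq ?_)
    · rw [← eval_average, hF.radial, map_mul, eval_linearForm, norm_mul]
      exact mul_le_mul (hB x hx) (ih x hx) (norm_nonneg _) ((norm_nonneg _).trans (hB x hx))
    · rw [Nat.factorial_succ]
      push_cast
      field_simp
      ring

theorem hasFDerivAt_eval (p : MvPolynomial (Fin N) ℂ) (z : Fin N → ℂ) :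
    ∃ L : (Fin N → ℂ) →L[ℂ] ℂ, HasFDerivAt (fun y => eval y p) L z ∧
      ∀ ξ, L ξ = eval z (directionalDeriv ξ p) := by
  induction p using MvPolynomial.induction_on with
  | C a =>
    refine ⟨0, ?_, fun ξ => by rw [derivation_C, map_zero]; rfl⟩
    simp only [eval_C]
    exact hasFDerivAt_const _ _
  | add p q hp hq =>
    obtain ⟨L, hL, hL'⟩ := hp
    obtain ⟨M, hM, hM'⟩ := hq
    refine ⟨L + M, ?_, fun ξ => by simp [hL', hM']⟩
    simp only [map_add]
    exact hL.add hM
  | mul_X p i hp =>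
    obtain ⟨L, hL, hL'⟩ := hp
    have hX : HasFDerivAt (fun y : Fin N → ℂ => y i)
      (ContinuousLinearMap.proj (R := ℂ) (φ := fun _ : Fin N => ℂ) i) z := hasFDerivAt_apply i z
    refine ⟨_, (hL.mul hX).congr_of_eventuallyEq (.of_forall fun y => ?_), fun ξ => ?_⟩
    · simp
    · simp [directionalDeriv_X, hL']

/-- A series of entire functions that converges normally on bounded sets can be differentiated
termwise, by the Cauchy estimates. -/
theorem hasFDerivAt_tsum_of_normally_summable {E : Type*} [NormedAddCommGroup E]
    [NormedSpace ℂ E] {F : ℕ → E → ℂ} (hF : ∀ n, Differentiable ℂ (F n))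
    (hb : ∀ r : ℝ, ∃ u : ℕ → ℝ, Summable u ∧
      ∀ n, ∀ z ∈ Metric.closedBall (0 : E) r, ‖F n z‖ ≤ u n) (z : E) :
    Summable (fun n => fderiv ℂ (F n) z) ∧
      HasFDerivAt (fun y => ∑' n, F n y) (∑' n, fderiv ℂ (F n) z) z := by
  obtain ⟨u, hu, hFu⟩ := hb (‖z‖ + 2)
  have hmem : z ∈ Metric.ball (0 : E) (‖z‖ + 1) := by
    rw [mem_ball_zero_iff]
    linarith
  have hd : ∀ n, ∀ x ∈ Metric.ball (0 : E) (‖z‖ + 1), ‖fderiv ℂ (F n) x‖ ≤ 2 * u n := by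
    intro n x hx
    rw [mem_ball_zero_iff] at hx
    have hx' : ∀ y ∈ Metric.ball x 1, ‖F n y‖ ≤ u n := fun y hy => by
      refine hFu n y ?_
      rw [mem_closedBall_zero_iff]
      rw [mem_ball_iff_norm] at hy
      have := norm_sub_norm_le y x
      linarith
    have := Complex.norm_fderiv_le_div_of_mapsTo_ball (f := F n) (c := x) (R₁ := 1)
      (R₂ := 2 * u n) (hF n).differentiableOn (fun y hy => by
        rw [mem_closedBall_iff_norm]
        have h1 := hx' y hy
        have h2 := hx' x (Metric.mem_ball_self one_pos)
        exact (norm_sub_le _ _).trans (by linarith)) one_pos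
    rwa [div_one] at this
  refine ⟨Summable.of_norm_bounded (hu.mul_left 2) fun n => hd n z hmem, ?_⟩
  refine hasFDerivAt_tsum_of_isPreconnected (hu.mul_left 2) Metric.isOpen_ball
    (convex_ball 0 _).isPreconnected (fun n x _ => (hF n x).hasFDerivAt) hd hmem ?_ hmem
  refine Summable.of_norm_bounded hu fun n => hFu n z ?_
  rw [mem_closedBall_zero_iff]
  linarith

theorem dunklOperator_eval (ξ : Fin N → ℂ) (p : MvPolynomial (Fin N) ℂ) {z : Fin N → ℂ}
    (hz : IsRegularPoint R z) :
    dunklOperator R μ ξ (fun y => eval y p) z = eval z (dunklPoly R μ ξ p) := by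
  obtain ⟨L, hL, hL'⟩ := hasFDerivAt_eval p z
  rw [dunklOperator, dunklPoly, hL.fderiv, hL', map_add, map_mul, map_sum, eval_C]
  congr 2
  refine Finset.sum_congr rfl fun α hα => ?_
  have h := congrArg (eval z) (linearForm_mul_dividedDiff α p)
  rw [map_mul, eval_linearForm, map_sub, eval_reflectPoly] at h
  rw [map_mul, eval_C, ← h, mul_div_cancel_left₀ _ (hz α hα)]

/-- Existence of the Dunkl kernel: the homogeneous components add up to an entire function. -/
theorem exists_isDunklEigenfunction (hR : IsRootSystem R) (hμ : IsMultiplicityFunction R μ)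
    (w : Fin N → ℂ) : ∃ f, IsDunklEigenfunction R μ w f := by
  obtain ⟨F, hF⟩ := exists_isRadialSequence hR hμ w
  have hb : ∀ r : ℝ, ∃ u : ℕ → ℝ, Summable u ∧
      ∀ n, ∀ z ∈ Metric.closedBall (0 : Fin N → ℂ) r, ‖eval z (F n)‖ ≤ u n := by
    intro r
    obtain ⟨B, hB⟩ := hF.exists_norm_eval_le hR hμ (N * r ^ 2)
    exact ⟨_, Real.summable_pow_div_factorial B, fun n z hz =>
      hB n z (closedBall_subset_hermitianBall r hz)⟩
  have hdiff : ∀ n, Differentiable ℂ fun z => eval z (F n) := fun n z => by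
    obtain ⟨L, hL, -⟩ := hasFDerivAt_eval (F n) z
    exact hL.differentiableAt
  have hS : ∀ z, HasSum (fun n => eval z (F n)) (∑' n, eval z (F n)) := fun z => by
    obtain ⟨u, hu, hFu⟩ := hb ‖z‖
    exact (Summable.of_norm_bounded hu fun n => hFu n z (by simp)).hasSum
  have hD := hasFDerivAt_tsum_of_normally_summable hdiff hb
  refine ⟨fun z => ∑' n, eval z (F n), fun z => (hD z).2.differentiableAt, ?_, ?_⟩
  · intro ξ z hz
    have h1 : HasSum (fun n => dunklOperator R μ ξ (fun y => eval y (F n)) z)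
        (dunklOperator R μ ξ (fun y => ∑' n, eval y (F n)) z) := by
      unfold dunklOperator
      rw [(hD z).2.fderiv]
      refine HasSum.add ?_ ?_
      · exact ((hD z).1.hasSum).mapL (ContinuousLinearMap.apply ℂ ℂ ξ)
      · exact (hasSum_sum fun α _ => (((hS z).sub (hS _)).div_const _).mul_left _).mul_left _
    simp only [dunklOperator_eval ξ _ hz] at h1
    have h2 : HasSum (fun n => eval z (dunklPoly R μ ξ (F (n + 1))))
        ((ξ ⬝ᵥ w) * ∑' n, eval z (F n)) := by
      simp only [hF.dunklPoly_succ hR hμ, map_mul, eval_C]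
      exact (hS z).mul_left _
    have h3 := (hasSum_nat_add_iff' (f := fun n => eval z (dunklPoly R μ ξ (F n))) 1).2 h1
    rw [Finset.sum_range_one, hF.zero, ← C_1, dunklPoly_C hR, map_zero, sub_zero] at h3
    exact h3.unique h2
  · refine (tsum_eq_single 0 fun n hn => ?_).trans (by simp [hF.zero])
    rw [MvPolynomial.eval_zero, constantCoeff_eq]
    obtain ⟨m, rfl⟩ := Nat.exists_eq_succ_of_ne_zero hn
    exact (hF.isHomogeneous (m + 1)).coeff_eq_zero (by simp)

end Polynomials

variable {R : Finset (EuclideanSpace ℝ (Fin N))} {μ : EuclideanSpace ℝ (Fin N) → ℝ}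

/-! ### Uniqueness of the Dunkl kernel -/

theorem dense_setOf_isRegularPoint (hR : IsRootSystem R) :
    Dense {z : Fin N → ℂ | IsRegularPoint R z} := by
  have h : {z : Fin N → ℂ | IsRegularPoint R z} =
      ⋂ α ∈ (R : Set (EuclideanSpace ℝ (Fin N))), {z | toComplexVec α ⬝ᵥ z ≠ 0} := by
    ext z
    simp [IsRegularPoint]
  rw [h]
  refine dense_biInter_of_isOpen (fun α _ => ?_) R.finite_toSet.countable fun α hα => ?_
  · exact isOpen_ne_fun (by unfold dotProduct; fun_prop) continuous_const
  · let K : Submodule ℂ (Fin N → ℂ) :=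
      LinearMap.ker (dotProductBilin ℂ ℂ (toComplexVec α))
    have hK : {z : Fin N → ℂ | toComplexVec α ⬝ᵥ z ≠ 0} = (K : Set (Fin N → ℂ))ᶜ := by
      ext z
      simp [K]
    rw [hK, ← interior_eq_empty_iff_dense_compl]
    by_contra hne
    have htop := K.eq_top_of_nonempty_interior' (Set.nonempty_iff_ne_empty.2 hne)
    have hmem : toComplexVec α ∈ K := htop ▸ Submodule.mem_top
    exact dotProduct_toComplexVec_self_ne_zero (hR.ne_zero hα) (by simpa [K] using hmem)

/-- Up to the factor `2πi`, the homogeneous component of degree `n` of an entire function `g`,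
as a Cauchy integral along the complex line through `z`. -/
noncomputable def cauchyComponent (g : (Fin N → ℂ) → ℂ) (n : ℕ) (z : Fin N → ℂ) : ℂ :=
  ∮ ζ in C(0, 1), (ζ ^ (n + 1))⁻¹ * g (ζ • z)

theorem circleIntegrable_inv_pow_mul {g : (Fin N → ℂ) → ℂ} (hg : Continuous g) (n : ℕ)
    (z : Fin N → ℂ) : CircleIntegrable (fun ζ => (ζ ^ n)⁻¹ * g (ζ • z)) 0 1 := by
  refine ContinuousOn.circleIntegrable zero_le_one (ContinuousOn.mul ?_ (by fun_prop))
  exact (continuous_pow n).continuousOn.inv₀ fun ζ hζ => pow_ne_zero _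
    (ne_zero_of_mem_unit_sphere ⟨ζ, hζ⟩)

theorem continuous_cauchyComponent {g : (Fin N → ℂ) → ℂ} (hg : Continuous g) (n : ℕ) :
    Continuous (cauchyComponent g n) := by
  unfold cauchyComponent circleIntegral
  refine intervalIntegral.continuous_parametric_intervalIntegral_of_continuous' ?_ _ _
  simp only [deriv_circleMap, smul_eq_mul, Function.uncurry_def]
  have h : Continuous fun x : (Fin N → ℂ) × ℝ => (circleMap 0 1 x.2 ^ (n + 1))⁻¹ :=
    Continuous.inv₀ (by fun_prop) fun x => pow_ne_zero _ (circleMap_ne_center one_ne_zero)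
  fun_prop

/-- The radial part `∑ z_i T_i g = (w·z) g` of the eigenvalue equation. -/
theorem fderiv_self_of_eigen {w : Fin N → ℂ} {g : (Fin N → ℂ) → ℂ}
    (hg : ∀ ξ z, IsRegularPoint R z → dunklOperator R μ ξ g z = (ξ ⬝ᵥ w) * g z)
    {z : Fin N → ℂ} (hz : IsRegularPoint R z) :
    fderiv ℂ g z z = (w ⬝ᵥ z) * g z -
      1 / 2 * ∑ α ∈ R, (μ α : ℂ) * (g z - g (complexReflection α z)) := by
  have h := hg z z hz
  have h1 : ∀ α ∈ R, (μ α : ℂ) * (toComplexVec α ⬝ᵥ z) *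
      ((g z - g (complexReflection α z)) / (toComplexVec α ⬝ᵥ z)) =
      (μ α : ℂ) * (g z - g (complexReflection α z)) := fun α hα => by
    rw [mul_assoc, mul_div_cancel₀ _ (hz α hα)]
  rw [dunklOperator, Finset.sum_congr rfl h1, dotProduct_comm] at h
  linear_combination h

/-- The radial equation for the Cauchy integrals, obtained by integrating the derivative of
`ζ ↦ ζ⁻ⁿ⁻¹ g (ζ z)` over the unit circle. -/
theorem cauchyComponent_average_of_isRegularPoint {w : Fin N → ℂ} {g : (Fin N → ℂ) → ℂ}
    (hd : Differentiable ℂ g)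
    (hg : ∀ ξ z, IsRegularPoint R z → dunklOperator R μ ξ g z = (ξ ⬝ᵥ w) * g z)
    (n : ℕ) {z : Fin N → ℂ} (hz : IsRegularPoint R z) :
    ((n + 1 : ℝ) : ℂ) * cauchyComponent g (n + 1) z + 1 / 2 * ∑ α ∈ R, (μ α : ℂ) *
      (cauchyComponent g (n + 1) z - cauchyComponent g (n + 1) (complexReflection α z)) =
        (w ⬝ᵥ z) * cauchyComponent g n z := by
  have hint := fun m y => circleIntegrable_inv_pow_mul hd.continuous m y
  have hderiv : ∀ ζ ∈ Metric.sphere (0 : ℂ) 1, HasDerivWithinAt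
      (fun ζ => (ζ ^ (n + 1))⁻¹ * g (ζ • z))
      ((w ⬝ᵥ z) * ((ζ ^ (n + 1))⁻¹ * g (ζ • z)) -
        (((n + 1 : ℝ) : ℂ) * ((ζ ^ (n + 1 + 1))⁻¹ * g (ζ • z)) +
          1 / 2 * ∑ α ∈ R, (μ α : ℂ) * ((ζ ^ (n + 1 + 1))⁻¹ * g (ζ • z) -
            (ζ ^ (n + 1 + 1))⁻¹ * g (ζ • complexReflection α z))))
      (Metric.sphere 0 1) ζ := by
    intro ζ hζ
    have hζ0 : ζ ≠ 0 := ne_zero_of_mem_unit_sphere ⟨ζ, hζ⟩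
    have h1 : HasDerivAt (fun ζ : ℂ => g (ζ • z)) (fderiv ℂ g (ζ • z) z) ζ := by
      have h2 : HasDerivAt (fun ζ : ℂ => ζ • z) z ζ := by
        simpa using (hasDerivAt_id ζ).smul_const z
      exact (hd (ζ • z)).hasFDerivAt.comp_hasDerivAt ζ h2
    have h3 : HasDerivAt (fun ζ : ℂ => (ζ ^ (n + 1))⁻¹)
        (-((n + 1 : ℝ) : ℂ) * (ζ ^ (n + 1 + 1))⁻¹) ζ := by
      refine ((hasDerivAt_pow (n + 1) ζ).fun_inv (pow_ne_zero _ hζ0)).congr_deriv ?_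
      push_cast
      field_simp
      ring
    have hreg : IsRegularPoint R (ζ • z) := fun α hα => by
      rw [dotProduct_smul]
      exact mul_ne_zero hζ0 (hz α hα)
    have h4 := fderiv_self_of_eigen hg hreg
    simp only [map_smul, smul_eq_mul, dotProduct_smul, complexReflection_smul] at h4
    have h5 : fderiv ℂ g (ζ • z) z = (w ⬝ᵥ z) * g (ζ • z) - ζ⁻¹ * (1 / 2 * ∑ α ∈ R, (μ α : ℂ) *
        (g (ζ • z) - g (ζ • complexReflection α z))) := by
      apply mul_left_cancel₀ hζ0
      rw [h4]
      field_simp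
    refine ((h3.mul h1).congr_deriv ?_).hasDerivWithinAt
    have h6 : ∑ α ∈ R, (μ α : ℂ) * ((ζ ^ (n + 1 + 1))⁻¹ * g (ζ • z) -
            (ζ ^ (n + 1 + 1))⁻¹ * g (ζ • complexReflection α z)) = (ζ ^ (n + 1 + 1))⁻¹ *
          ∑ α ∈ R, (μ α : ℂ) * (g (ζ • z) - g (ζ • complexReflection α z)) := by
      rw [Finset.mul_sum]
      exact Finset.sum_congr rfl fun α _ => by ring
    rw [h5, h6, pow_succ ζ (n + 1), mul_inv]
    ring
  have h0 := circleIntegral.integral_eq_zero_of_hasDerivWithinAt zero_le_one hderiv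
  have hi1 : ∀ (c : ℂ) (f : ℂ → ℂ), CircleIntegrable f 0 1 →
      CircleIntegrable (fun ζ => c * f ζ) 0 1 := fun c f hf => hf.const_fun_smul (a := c)
  have hi2 : ∀ α ∈ R, CircleIntegrable (fun ζ => (μ α : ℂ) * ((ζ ^ (n + 1 + 1))⁻¹ * g (ζ • z) -
      (ζ ^ (n + 1 + 1))⁻¹ * g (ζ • complexReflection α z))) 0 1 := fun α _ =>
    hi1 _ _ ((hint _ _).sub (hint _ _))
  have hi3 := hi1 (1 / 2) _ (CircleIntegrable.fun_sum R hi2)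
  have hi4 : CircleIntegrable (fun ζ => ((n + 1 : ℝ) : ℂ) * ((ζ ^ (n + 1 + 1))⁻¹ * g (ζ • z)) +
      1 / 2 * ∑ α ∈ R, (μ α : ℂ) * ((ζ ^ (n + 1 + 1))⁻¹ * g (ζ • z) -
        (ζ ^ (n + 1 + 1))⁻¹ * g (ζ • complexReflection α z))) 0 1 :=
    (hi1 _ _ (hint _ _)).add hi3
  rw [circleIntegral.integral_sub (hi1 _ _ (hint _ _)) hi4,
    circleIntegral.integral_add (hi1 _ _ (hint _ _)) hi3, circleIntegral.integral_const_mul,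
    circleIntegral.integral_const_mul, circleIntegral.integral_const_mul,
    circleIntegral.integral_fun_sum hi2] at h0
  have h7 : ∀ α ∈ R, (∮ ζ in C(0, 1), (μ α : ℂ) * ((ζ ^ (n + 1 + 1))⁻¹ * g (ζ • z) -
      (ζ ^ (n + 1 + 1))⁻¹ * g (ζ • complexReflection α z))) = (μ α : ℂ) *
      (cauchyComponent g (n + 1) z - cauchyComponent g (n + 1) (complexReflection α z)) :=
    fun α _ => by
      rw [circleIntegral.integral_const_mul, circleIntegral.integral_sub (hint _ _) (hint _ _)]
      rfl
  rw [Finset.sum_congr rfl h7] at h0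
  exact (sub_eq_zero.1 h0).symm

theorem cauchyComponent_average {w : Fin N → ℂ} {g : (Fin N → ℂ) → ℂ}
    (hR : IsRootSystem R) (hd : Differentiable ℂ g)
    (hg : ∀ ξ z, IsRegularPoint R z → dunklOperator R μ ξ g z = (ξ ⬝ᵥ w) * g z)
    (n : ℕ) (z : Fin N → ℂ) :
    ((n + 1 : ℝ) : ℂ) * cauchyComponent g (n + 1) z + 1 / 2 * ∑ α ∈ R, (μ α : ℂ) *
      (cauchyComponent g (n + 1) z - cauchyComponent g (n + 1) (complexReflection α z)) =
        (w ⬝ᵥ z) * cauchyComponent g n z := by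
  suffices h : (fun z => ((n + 1 : ℝ) : ℂ) * cauchyComponent g (n + 1) z +
      1 / 2 * ∑ α ∈ R, (μ α : ℂ) * (cauchyComponent g (n + 1) z -
        cauchyComponent g (n + 1) (complexReflection α z))) =
      fun z => (w ⬝ᵥ z) * cauchyComponent g n z from congrFun h z
  have hcont := continuous_cauchyComponent hd.continuous
  have hw : Continuous fun z : Fin N → ℂ => w ⬝ᵥ z := by
    unfold dotProduct
    fun_prop
  exact Continuous.ext_on (dense_setOf_isRegularPoint hR)
    ((continuous_const.mul (hcont _)).add (continuous_const.mul (continuous_finsetSum _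
      fun α _ => continuous_const.mul ((hcont _).sub
        ((hcont _).comp (continuous_complexReflection α))))))
    (hw.mul (hcont n)) fun z hz => cauchyComponent_average_of_isRegularPoint hd hg n hz

theorem eq_zero_of_cauchyComponent_eq_zero {g : (Fin N → ℂ) → ℂ} (hd : Differentiable ℂ g)
    (h : ∀ n z, cauchyComponent g n z = 0) (z : Fin N → ℂ) : g z = 0 := by
  -- The power series of `ζ ↦ g (2 ζ z)` on the unit disc is evaluated at `ζ = 1/2`.
  have hφ : Differentiable ℂ fun ζ : ℂ => g (ζ • (2 : ℂ) • z) := by fun_prop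
  have hs := ((hφ.differentiableOn (s := Metric.closedBall 0 ((1 : NNReal) : ℝ))
    ).hasFPowerSeriesOnBall one_pos).hasSum (y := 1 / 2) (by
      rw [Metric.mem_eball, edist_zero_right, enorm_lt_coe]
      rw [← NNReal.coe_lt_coe]
      norm_num)
  simp only [cauchyPowerSeries_apply] at hs
  have h0 : ∀ n : ℕ, (∮ ζ in C(0, ((1 : NNReal) : ℝ)), ((1 / 2 : ℂ) / (ζ - 0)) ^ n •
      (ζ - 0)⁻¹ • g (ζ • (2 : ℂ) • z)) = 0 := by
    intro n
    calc _ = ∮ ζ in C(0, 1), (1 / 2 : ℂ) ^ n * ((ζ ^ (n + 1))⁻¹ * g (ζ • (2 : ℂ) • z)) := by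
          rw [NNReal.coe_one]
          refine circleIntegral.integral_congr zero_le_one fun ζ _ => ?_
          simp only [sub_zero, smul_eq_mul, pow_succ, mul_inv, div_eq_mul_inv]
          ring
      _ = (1 / 2 : ℂ) ^ n * cauchyComponent g n ((2 : ℂ) • z) :=
          circleIntegral.integral_const_mul _ _ _ _
      _ = 0 := by rw [h, mul_zero]
  have hz : ((0 : ℂ) + 1 / 2) • (2 : ℂ) • z = z := by
    rw [smul_smul]
    norm_num
  rw [hz] at hs
  refine hs.unique ?_
  simp only [h0, smul_zero]
  exact hasSum_zero

/-- The maximum principle kills the homogeneous components of an entire joint eigenfunction one after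
the other, once it vanishes at the origin. -/
theorem eq_zero_of_eigen (hR : IsRootSystem R) (hμ : IsMultiplicityFunction R μ)
    {w : Fin N → ℂ} {g : (Fin N → ℂ) → ℂ} (hd : Differentiable ℂ g)
    (hg : ∀ ξ z, IsRegularPoint R z → dunklOperator R μ ξ g z = (ξ ⬝ᵥ w) * g z)
    (h0 : g 0 = 0) : g = 0 := by
  funext z
  refine eq_zero_of_cauchyComponent_eq_zero hd (fun n => ?_) z
  induction n with
  | zero =>
    intro z
    have h1 : Differentiable ℂ fun ζ : ℂ => g (ζ • z) := by fun_prop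
    have h2 := h1.differentiableOn.circleIntegral_sub_inv_smul (R := 1) (c := 0) (w := 0)
      (by simp)
    simpa [cauchyComponent, h0] using h2
  | succ n ih =>
    intro z
    obtain ⟨r, hz, -⟩ := exists_mem_hermitianBall z z
    have key := norm_le_div_of_norm_averaging_le (isCompact_hermitianBall r) R μ hμ.nonneg
      complexReflection (hR.mapsTo_hermitianBall r) (H := cauchyComponent g (n + 1))
      (continuous_cauchyComponent hd.continuous _).continuousOn (c := n + 1) (by positivity)
      (M := 0) (fun x _ => by
        rw [cauchyComponent_average hR hd hg, ih, mul_zero, norm_zero]) z hz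
    simpa using key

theorem IsDunklEigenfunction.unique (hR : IsRootSystem R) (hμ : IsMultiplicityFunction R μ)
    {w : Fin N → ℂ} {f g : (Fin N → ℂ) → ℂ} (hf : IsDunklEigenfunction R μ w f)
    (hg : IsDunklEigenfunction R μ w g) : f = g := by
  refine sub_eq_zero.1 (eq_zero_of_eigen hR hμ (w := w) (hf.differentiable.sub hg.differentiable)
    (fun ξ z hz => ?_) (by rw [Pi.sub_apply, hf.map_zero, hg.map_zero, sub_self]))
  have h1 := hf.eigen ξ z hz
  have h2 := hg.eigen ξ z hz
  have h3 : dunklOperator R μ ξ (f - g) z = dunklOperator R μ ξ f z - dunklOperator R μ ξ g z := by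
    unfold dunklOperator
    rw [fderiv_sub (hf.differentiable z) (hg.differentiable z), _root_.sub_apply]
    simp only [Pi.sub_apply]
    rw [add_sub_add_comm, ← mul_sub, ← Finset.sum_sub_distrib]
    congr 2
    exact Finset.sum_congr rfl fun α _ => by ring
  rw [h3, h1, h2, Pi.sub_apply]
  ring

/-! ### Properties of the Dunkl kernel -/

theorem isDunklEigenfunction_dunklKernel (hR : IsRootSystem R) (hμ : IsMultiplicityFunction R μ)
    (w : Fin N → ℂ) : IsDunklEigenfunction R μ w fun z => dunklKernel R μ z w := by
  have h := exists_isDunklEigenfunction hR hμ w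
  simp only [dunklKernel, dif_pos h]
  exact h.choose_spec

theorem dunklKernel_zero_left (hR : IsRootSystem R) (hμ : IsMultiplicityFunction R μ)
    (w : Fin N → ℂ) : dunklKernel R μ 0 w = 1 :=
  (isDunklEigenfunction_dunklKernel hR hμ w).map_zero

theorem dunklKernel_zero_right (hR : IsRootSystem R) (hμ : IsMultiplicityFunction R μ)
    (z : Fin N → ℂ) : dunklKernel R μ z 0 = 1 := by
  refine congrFun ((isDunklEigenfunction_dunklKernel hR hμ 0).unique hR hμ (g := fun _ => 1)
    ⟨differentiable_const 1, fun ξ z _ => ?_, rfl⟩) z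
  simp [dunklOperator]

theorem dunklKernel_smul_left (hR : IsRootSystem R) (hμ : IsMultiplicityFunction R μ)
    {c : ℂ} (hc : c ≠ 0) (z w : Fin N → ℂ) :
    dunklKernel R μ (c • z) w = dunklKernel R μ z (c • w) := by
  have h := isDunklEigenfunction_dunklKernel hR hμ w
  refine congrFun (IsDunklEigenfunction.unique hR hμ (w := c • w)
    (f := fun z => dunklKernel R μ (c • z) w) ⟨?_, fun ξ z hz => ?_, ?_⟩
    (isDunklEigenfunction_dunklKernel hR hμ (c • w))) z
  · exact h.differentiable.comp (differentiable_id.const_smul c)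
  · have hreg : IsRegularPoint R (c • z) := fun α hα => by
      rw [dotProduct_smul]
      exact mul_ne_zero hc (hz α hα)
    have h1 := h.eigen ξ (c • z) hreg
    have h2 : HasFDerivAt (fun z => dunklKernel R μ (c • z) w)
        (c • fderiv ℂ (fun z => dunklKernel R μ z w) (c • z)) z := by
      have h3 := (h.differentiable (c • z)).hasFDerivAt.comp z ((hasFDerivAt_id z).const_smul c)
      refine h3.congr_fderiv ?_
      ext v
      simp
    rw [dotProduct_smul, smul_eq_mul, mul_assoc, ← h1]
    unfold dunklOperator
    rw [h2.fderiv, mul_add, _root_.smul_apply, smul_eq_mul, mul_left_comm c (1 / 2),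
      Finset.mul_sum R _ c]
    congr 2
    refine Finset.sum_congr rfl fun α hα => ?_
    have h4 := hz α hα
    rw [complexReflection_smul, dotProduct_smul, smul_eq_mul]
    field_simp
  · simp only [smul_zero, h.map_zero]

/-! ### Relations between the integral kernels -/

variable {t : ℝ}

theorem kernelA_zero_left (hR : IsRootSystem R) (hμ : IsMultiplicityFunction R μ)
    (q : EuclideanSpace ℝ (Fin N)) :
    kernelA R μ t 0 q = ((Real.exp (-‖q‖ ^ 2 / (4 * t)) : ℝ) : ℂ) := by
  rw [kernelA, smul_zero, dunklKernel_zero_left hR hμ, dotProduct_zero,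
    dotProduct_toComplexVec_self, mul_one]
  push_cast
  congr 1
  ring

theorem dunklRho_zero_left (hR : IsRootSystem R) (hμ : IsMultiplicityFunction R μ)
    (q : EuclideanSpace ℝ (Fin N)) :
    dunklRho R μ t 0 (toComplexVec q) = ((Real.exp (-‖q‖ ^ 2 / (2 * t)) : ℝ) : ℂ) := by
  rw [dunklRho, smul_zero, dunklKernel_zero_left hR hμ, dotProduct_zero,
    dotProduct_toComplexVec_self, mul_one]
  push_cast
  congr 1
  ring

theorem kernelA_zero_left_ne_zero (hR : IsRootSystem R) (hμ : IsMultiplicityFunction R μ)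
    (q : EuclideanSpace ℝ (Fin N)) : kernelA R μ t 0 q ≠ 0 := by
  rw [kernelA_zero_left hR hμ]
  exact_mod_cast (Real.exp_pos _).ne'

theorem kernelC_eq_mul (hR : IsRootSystem R) (hμ : IsMultiplicityFunction R μ)
    (z : Fin N → ℂ) (q : EuclideanSpace ℝ (Fin N)) :
    kernelC R μ t z q = kernelA R μ t 0 q * kernelA R μ t z q := by
  rw [kernelA_zero_left hR hμ, kernelA, kernelC, dunklRho, ← mul_assoc, Complex.ofReal_exp,
    ← Complex.exp_add, dotProduct_toComplexVec_self]
  congr 2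
  push_cast
  ring

theorem dunklRho_zero_left_eq_sq (hR : IsRootSystem R) (hμ : IsMultiplicityFunction R μ)
    (q : EuclideanSpace ℝ (Fin N)) :
    dunklRho R μ t 0 (toComplexVec q) = kernelA R μ t 0 q ^ 2 := by
  rw [sq]
  exact kernelC_eq_mul hR hμ 0 q

theorem kernelB_eq_div (hR : IsRootSystem R) (hμ : IsMultiplicityFunction R μ)
    (z : Fin N → ℂ) (q : EuclideanSpace ℝ (Fin N)) :
    kernelB R μ t z q = kernelA R μ t z q / kernelA R μ t 0 q := by
  have h : kernelB R μ t z q = kernelC R μ t z q / dunklRho R μ t 0 (toComplexVec q) := rfl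
  rw [h, kernelC_eq_mul hR hμ, dunklRho_zero_left_eq_sq hR hμ, sq,
    mul_div_mul_left _ _ (kernelA_zero_left_ne_zero hR hμ q)]

theorem kernelC_zero_left_cpow (hR : IsRootSystem R) (hμ : IsMultiplicityFunction R μ)
    (q : EuclideanSpace ℝ (Fin N)) :
    kernelC R μ t 0 q ^ (1 / 2 : ℂ) = kernelA R μ t 0 q := by
  have h : ((1 / 2 : ℝ) : ℂ) = 1 / 2 := by norm_num
  rw [kernelC, dunklRho_zero_left hR hμ, kernelA_zero_left hR hμ, ← h,
    ← Complex.ofReal_cpow (Real.exp_pos _).le, ← Real.exp_mul]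
  congr 2
  ring

theorem kernelA_eq_div (hR : IsRootSystem R) (hμ : IsMultiplicityFunction R μ)
    (z : Fin N → ℂ) (q : EuclideanSpace ℝ (Fin N)) :
    kernelA R μ t z q = kernelC R μ t z q / kernelC R μ t 0 q ^ (1 / 2 : ℂ) := by
  rw [kernelC_zero_left_cpow hR hμ, kernelC_eq_mul hR hμ,
    mul_div_cancel_left₀ _ (kernelA_zero_left_ne_zero hR hμ q)]

theorem kernelC_two_smul (hR : IsRootSystem R) (hμ : IsMultiplicityFunction R μ) (ht : 0 < t)
    (z : Fin N → ℂ) (q : EuclideanSpace ℝ (Fin N)) :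
    kernelC R μ t ((2 : ℂ) • z) q =
      kernelA R μ (2 * t) ((2 : ℂ) • z) 0 * kernelA R μ (t / 2) z q := by
  have h0 : toComplexVec (0 : EuclideanSpace ℝ (Fin N)) = 0 := by
    ext i
    simp [toComplexVec]
  have h2 : (Real.sqrt 2 : ℂ) ≠ 0 := by
    exact_mod_cast (Real.sqrt_pos.2 two_pos).ne'
  have hs : (Real.sqrt (t / 2) : ℂ)⁻¹ = Real.sqrt 2 * (Real.sqrt t : ℂ)⁻¹ := by
    rw [Real.sqrt_div ht.le]
    push_cast
    rw [inv_div, div_eq_mul_inv]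
  have h22 : (2 : ℂ) = Real.sqrt 2 * Real.sqrt 2 := by
    rw [← Complex.ofReal_mul, Real.mul_self_sqrt zero_le_two, Complex.ofReal_ofNat]
  -- `t/2` in place of `t` rescales both arguments by `√2`; by homogeneity of the Dunkl kernel this
  -- amounts to rescaling the first argument alone by `2`.
  have hE : dunklKernel R μ ((Real.sqrt (t / 2) : ℂ)⁻¹ • z)
      ((Real.sqrt (t / 2) : ℂ)⁻¹ • toComplexVec q) =
      dunklKernel R μ ((Real.sqrt t : ℂ)⁻¹ • (2 : ℂ) • z)
        ((Real.sqrt t : ℂ)⁻¹ • toComplexVec q) := by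
    rw [hs, mul_smul _ _ (toComplexVec q), ← dunklKernel_smul_left hR hμ h2, smul_smul, smul_smul]
    congr 2
    rw [mul_comm _ (2 : ℂ), h22]
    ring
  have ht' : (t : ℂ) ≠ 0 := by exact_mod_cast ht.ne'
  rw [kernelC, dunklRho, kernelA, kernelA, hE, h0, smul_zero, dunklKernel_zero_right hR hμ, mul_one,
    ← mul_assoc, ← Complex.exp_add]
  congr 2
  simp only [dotProduct_smul, smul_dotProduct, smul_eq_mul, dotProduct_zero]
  push_cast
  field_simp
  ring

end DunklKernel

theorem mainTheorem2 {N : ℕ} (hN : 1 ≤ N)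
    (R : Finset (EuclideanSpace ℝ (Fin N))) (hR : IsRootSystem R)
    (μ : EuclideanSpace ℝ (Fin N) → ℝ) (hμ : IsMultiplicityFunction R μ)
    (t : ℝ) (ht : 0 < t) :
    -- the identities; the value of `σ` makes all denominators nonzero and `C(0,q)` positive
    (∀ (z : Fin N → ℂ) (q : EuclideanSpace ℝ (Fin N)),
      dunklSigma R μ t q = ((Real.exp (-‖q‖ ^ 2 / (2 * t)) : ℝ) : ℂ) ∧
      kernelB R μ t z q = kernelA R μ t z q / kernelA R μ t 0 q ∧
      dunklRho R μ t z (toComplexVec q) = kernelC R μ t z q ∧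
      kernelC R μ t z q = kernelA R μ t 0 q * kernelA R μ t z q ∧
      dunklSigma R μ t q = dunklRho R μ t 0 (toComplexVec q) ∧
      dunklRho R μ t 0 (toComplexVec q) = kernelA R μ t 0 q ^ 2 ∧
      kernelC R μ t ((2 : ℂ) • z) q =
        kernelA R μ (2 * t) ((2 : ℂ) • z) 0 * kernelA R μ (t / 2) z q ∧
      kernelA R μ t z q = kernelC R μ t z q / (kernelC R μ t 0 q) ^ (1 / 2 : ℂ) ∧
      kernelB R μ t z q = kernelC R μ t z q / kernelC R μ t 0 q ∧
      dunklRho R μ t 0 (toComplexVec q) = kernelC R μ t 0 q) ∧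
    -- Version A determines Versions B, C and the heat kernel, and so does Version C for A, B
    (∀ (R' : Finset (EuclideanSpace ℝ (Fin N))) (μ' : EuclideanSpace ℝ (Fin N) → ℝ) (t' : ℝ),
      IsRootSystem R' → IsMultiplicityFunction R' μ' → 0 < t' →
      (kernelA R μ t = kernelA R' μ' t' →
        kernelB R μ t = kernelB R' μ' t' ∧ kernelC R μ t = kernelC R' μ' t' ∧
          dunklSigma R μ t = dunklSigma R' μ' t') ∧
      (kernelC R μ t = kernelC R' μ' t' →
        kernelA R μ t = kernelA R' μ' t' ∧ kernelB R μ t = kernelB R' μ' t' ∧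
          dunklSigma R μ t = dunklSigma R' μ' t')) := by
  refine ⟨fun z q => ⟨dunklRho_zero_left hR hμ q, kernelB_eq_div hR hμ z q, rfl,
    kernelC_eq_mul hR hμ z q, rfl, dunklRho_zero_left_eq_sq hR hμ q, kernelC_two_smul hR hμ ht z q,
    kernelA_eq_div hR hμ z q, rfl, rfl⟩, fun R' μ' t' hR' hμ' _ => ⟨fun h => ?_, fun h => ?_⟩⟩
  · refine ⟨funext₂ fun z q => ?_, funext₂ fun z q => ?_, funext fun q => ?_⟩
    · rw [kernelB_eq_div hR hμ, kernelB_eq_div hR' hμ', h]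
    · rw [kernelC_eq_mul hR hμ, kernelC_eq_mul hR' hμ', h]
    · rw [dunklSigma, dunklSigma, dunklRho_zero_left_eq_sq hR hμ, dunklRho_zero_left_eq_sq hR' hμ',
        h]
  · refine ⟨funext₂ fun z q => ?_, funext₂ fun z q => ?_, funext fun q => ?_⟩
    · rw [kernelA_eq_div hR hμ, kernelA_eq_div hR' hμ', h]
    · exact congrArg (fun C : (Fin N → ℂ) → EuclideanSpace ℝ (Fin N) → ℂ => C z q / C 0 q) h
    · exact congrFun₂ h 0 q
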